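/- Let $R:\mathbb{CP}^2\dashrightarrow\mathbb{CP}^2$ be the Migdal--Kadanoff renormalization map, i.e. the rational map induced by the homogeneous polynomial map $$\hat R(U,V,W)=\bigl((U^2+V^2)^2,\;V^2(U+W)^2,\;(V^2+W^2)^2\bigr)$$ of $\mathbb{C}^3$, and let $R^n$ be its $n$-th iterate, defined where no point of the orbit $x, Rx,\dots,R^{n-1}x$ is a point of indeterminacy of $R$; thus $R^n[X]=[\hat R^nX]$ where $\hat R^nX\neq0$. Let $Y=pU+qV+rW$ be a linear form on $\mathbb{C}^3$ with $p,q,r\in\mathbb{C}$, $p\neq0$, $r\neq0$. Let $\sigma_Y$ be the section of the co-tautological line bundle over $\mathbb{CP}^2$ (whose fibre over a point is the dual of the line in $\mathbb{C}^3$ representing that point) given by restricting $Y$ to each line, and let $\|\cdot\|$ be the standard Hermitian norm on this bundle, so that $\|\sigma_Y([X])\|=|Y(X)|/\|X\|$ with the Euclidean norm on $\mathbb{C}^3$. Then, for each $n\ge0$, $\sigma_Y\circ R^n$ is defined and non-zero almost everywhere on $\mathbb{CP}^2$, the function $4^{-n}\log\|\sigma_Y\circ R^n\|$ belongs to $L^1(\mathbb{CP}^2)$,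 and $$\frac1{4^n}\log\|\sigma_Y\circ R^n\|\longrightarrow0\quad\text{in } L^1(\mathbb{CP}^2)\quad\text{as } n\to\infty .$$ Here $\mathbb{CP}^2$ carries the Fubini--Study volume normalized to total mass $1$ (since $\mathbb{CP}^2$ is compact, any smooth volume form gives the same notion of convergence, and $L^1=L^1_{\mathrm{loc}}$). -/

import Mathlib

open MeasureTheory Filter Topology

noncomputable section

namespace MigdalKadanoff

/-- `ℂ³` with its standard Hermitian (Euclidean) norm; the coordinates `0, 1, 2` are `U, V, W`. -/
abbrev C3 : Type := EuclideanSpace ℂ (Fin 3)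

/-- The complex projective plane, with homogeneous coordinates `[U : V : W]`. -/
abbrev CP2 : Type := Projectivization ℂ C3

/-- The quotient topology of the projection `ℂ³ ∖ {0} → ℂℙ²`. -/
instance : TopologicalSpace CP2 := .coinduced (Projectivization.mk' ℂ) inferInstance

/-- The Borel σ-algebra of `ℂℙ²`. -/
instance : MeasurableSpace CP2 := borel CP2

instance : BorelSpace CP2 := ⟨rfl⟩

/-! ### The Fubini–Study volume -/

/-- The Hopf map from the unit sphere of `ℂ³` to `ℂℙ²`. -/
def hopf (v : Metric.sphere (0 : C3) 1) : CP2 :=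
  Projectivization.mk ℂ (v : C3) (ne_zero_of_mem_unit_sphere v)

theorem continuous_hopf : Continuous hopf := by
  have h : Continuous (Projectivization.mk' ℂ : {v : C3 // v ≠ 0} → CP2) :=
    continuous_coinduced_rng
  exact h.comp (Continuous.subtype_mk continuous_subtype_val ne_zero_of_mem_unit_sphere)

/-- The surface measure of the unit sphere `S⁵ ⊆ ℂ³` (up to a constant factor, which the
normalization below removes). -/
def sphereMeasure : Measure (Metric.sphere (0 : C3) 1) :=
  (Measure.addHaar : Measure C3).toSphere

/-- The Fubini–Study volume on `ℂℙ²`, normalized to total mass `1`: the image under the Hopf map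
of the uniform probability measure on `S⁵`. -/
def fubiniStudy : Measure CP2 :=
  ((sphereMeasure Set.univ)⁻¹ • sphereMeasure).map hopf

instance : IsProbabilityMeasure fubiniStudy := by
  have : NeZero sphereMeasure := ⟨Measure.toSphere_ne_zero _⟩
  have : IsFiniteMeasure sphereMeasure := by unfold sphereMeasure; infer_instance
  exact Measure.isProbabilityMeasure_map continuous_hopf.measurable.aemeasurable

/-! ### The Migdal–Kadanoff renormalization -/

/-- The homogeneous polynomial map
`R̂ (U, V, W) = ((U² + V²)², V² (U + W)², (V² + W²)²)` of `ℂ³`. -/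
def RHat (X : C3) : C3 :=
  !₂[(X 0 ^ 2 + X 1 ^ 2) ^ 2, X 1 ^ 2 * (X 0 + X 2) ^ 2, (X 1 ^ 2 + X 2 ^ 2) ^ 2]

theorem RHat_smul (c : ℂ) (X : C3) : RHat (c • X) = c ^ 4 • RHat X := by
  ext i
  fin_cases i <;> simp [RHat] <;> ring

theorem RHat_zero : RHat 0 = 0 := by
  simpa using RHat_smul 0 0

/-- The rational self-map `R` of `ℂℙ²` induced by `R̂`: a partial function, undefined exactly at
the points of indeterminacy. -/
def R : CP2 → Part CP2 := fun x =>
  ⟨RHat x.rep ≠ 0, fun h => Projectivization.mk ℂ (RHat x.rep) h⟩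

/-- `R [X] = [R̂ X]` for every choice of the homogeneous coordinates `X`. -/
theorem mem_R_mk (X : C3) (hX : X ≠ 0) (y : CP2) :
    y ∈ R (Projectivization.mk ℂ X hX) ↔
      ∃ h : RHat X ≠ 0, Projectivization.mk ℂ (RHat X) h = y := by
  obtain ⟨a, ha⟩ := Projectivization.exists_smul_eq_mk_rep ℂ X hX
  have ha' : RHat (Projectivization.mk ℂ X hX).rep = (a : ℂ) ^ 4 • RHat X := by
    rw [← ha, Units.smul_def, RHat_smul]
  have h4 : (a : ℂ) ^ 4 ≠ 0 := pow_ne_zero _ a.ne_zero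
  constructor
  · rintro ⟨h, rfl⟩
    have h' : RHat (Projectivization.mk ℂ X hX).rep ≠ 0 := h
    have hne : RHat X ≠ 0 := fun h0 => h' (by rw [ha', h0, smul_zero])
    refine ⟨hne, ?_⟩
    change _ = Projectivization.mk ℂ (RHat (Projectivization.mk ℂ X hX).rep) h'
    rw [eq_comm, Projectivization.mk_eq_mk_iff']
    exact ⟨_, ha'.symm⟩
  · rintro ⟨h, rfl⟩
    have h' : RHat (Projectivization.mk ℂ X hX).rep ≠ 0 := by
      rw [ha']; exact smul_ne_zero h4 h
    refine ⟨h', ?_⟩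
    change Projectivization.mk ℂ (RHat (Projectivization.mk ℂ X hX).rep) h' = _
    rw [Projectivization.mk_eq_mk_iff']
    exact ⟨_, ha'.symm⟩

/-- The iterates `Rⁿ`, as compositions of partial functions. -/
def iterR : ℕ → CP2 → Part CP2
  | 0, x => Part.some x
  | n + 1, x => (iterR n x).bind R

/-- `Rⁿ [X] = [R̂ⁿ X]`, and `Rⁿ` is defined at `[X]` exactly when `R̂ⁿ X ≠ 0`. -/
theorem mem_iterR_mk (n : ℕ) (X : C3) (hX : X ≠ 0) (y : CP2) :
    y ∈ iterR n (Projectivization.mk ℂ X hX) ↔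
      ∃ h : RHat^[n] X ≠ 0, Projectivization.mk ℂ (RHat^[n] X) h = y := by
  induction n generalizing y with
  | zero => simp [iterR, hX, eq_comm]
  | succ n ih =>
    rw [iterR, Part.mem_bind_iff]
    simp only [Function.iterate_succ_apply']
    constructor
    · rintro ⟨z, hz, hy⟩
      obtain ⟨h, rfl⟩ := (ih z).1 hz
      exact (mem_R_mk _ h y).1 hy
    · rintro ⟨h, hy⟩
      have h0 : RHat^[n] X ≠ 0 := fun h0 => h (by rw [h0, RHat_zero])
      exact ⟨_, (ih _).2 ⟨h0, rfl⟩, (mem_R_mk _ h0 y).2 ⟨h, hy⟩⟩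

/-! ### The co-tautological line bundle -/

/-- The linear form `Y = p U + q V + r W` on `ℂ³`. -/
def linForm (p q r : ℂ) : C3 →L[ℂ] ℂ :=
  p • EuclideanSpace.proj 0 + q • EuclideanSpace.proj 1 + r • EuclideanSpace.proj 2

theorem linForm_apply (p q r : ℂ) (X : C3) : linForm p q r X = p * X 0 + q * X 1 + r * X 2 := rfl

/-- The fibre of the co-tautological line bundle over `x ∈ ℂℙ²`: the dual of the line in `ℂ³`
that `x` represents. Its operator norm is the standard Hermitian norm of the bundle. -/
abbrev Cotaut (x : CP2) : Type := x.submodule →L[ℂ] ℂ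

/-- The section `σ_Y` of the co-tautological line bundle determined by a linear form `Y`: over each
point, the restriction of `Y` to the corresponding line. -/
def sec (Y : C3 →L[ℂ] ℂ) (x : CP2) : Cotaut x := Y.comp x.submodule.subtypeL

/-- `‖σ_Y [X]‖ = |Y X| / ‖X‖`. -/
theorem norm_sec_mk (Y : C3 →L[ℂ] ℂ) (X : C3) (hX : X ≠ 0) :
    ‖sec Y (Projectivization.mk ℂ X hX)‖ = ‖Y X‖ / ‖X‖ := by
  have hX' : 0 < ‖X‖ := norm_pos_iff.2 hX
  have hmem : X ∈ (Projectivization.mk ℂ X hX).submodule := by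
    rw [Projectivization.submodule_mk]; exact Submodule.mem_span_singleton_self X
  apply le_antisymm
  · refine ContinuousLinearMap.opNorm_le_bound _ (by positivity) ?_
    rintro ⟨v, hv⟩
    rw [Projectivization.submodule_mk] at hv
    obtain ⟨c, rfl⟩ := Submodule.mem_span_singleton.1 hv
    change ‖Y (c • X)‖ ≤ ‖Y X‖ / ‖X‖ * ‖c • X‖
    rw [map_smul, norm_smul, norm_smul]
    apply le_of_eq
    field_simp
  · rw [div_le_iff₀ hX']
    exact (sec Y (Projectivization.mk ℂ X hX)).le_opNorm ⟨X, hmem⟩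

open Classical in
/-- The function `4⁻ⁿ log ‖σ_Y ∘ Rⁿ‖`, with the value `0` where `Rⁿ` is undefined or `σ_Y ∘ Rⁿ`
vanishes. -/
def potential (Y : C3 →L[ℂ] ℂ) (n : ℕ) (x : CP2) : ℝ :=
  if h : (iterR n x).Dom then (1 / 4 ^ n) * Real.log ‖sec Y ((iterR n x).get h)‖ else 0

/-- The same function in homogeneous coordinates. -/
theorem potential_mk (Y : C3 →L[ℂ] ℂ) (n : ℕ) (X : C3) (hX : X ≠ 0) (h : RHat^[n] X ≠ 0) :
    potential Y n (Projectivization.mk ℂ X hX) =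
      (1 / 4 ^ n) * Real.log (‖Y (RHat^[n] X)‖ / ‖RHat^[n] X‖) := by
  obtain ⟨hd, hy⟩ := (mem_iterR_mk n X hX _).2 ⟨h, rfl⟩
  rw [potential, dif_pos hd, hy, norm_sec_mk]

end MigdalKadanoff

end

/-!
The idea is to measure how much a pullback by `R` can enlarge the moments of a positive function
on `ℂℙ²`. The theorem says that `log (1 / ‖σ_Y ∘ Rⁿ‖)` has integral `o(4ⁿ)`; this follows once some
moment of `1 / ‖σ_Y ∘ Rⁿ‖` of order `αⁿ`, with a fixed `α > 1/4`, stays bounded in `n`, because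
`log t ≤ t ^ β / β` with `β = αⁿ` then bounds the integral by a constant times `α⁻ⁿ`.

Such a bound comes from iterating a one-step estimate `∫ (g ∘ R) ^ α ≤ C (∫ g) ^ α` for all
measurable `g ≥ 0` (`exists_lintegral_comp_RHat_rpow_le`,
`exists_lintegral_comp_iterate_rpow_le`). By Hölder's inequality it holds as soon as
`|det DR̂| ^ (-2 α / (1 - α))` is integrable, since the change of variables `Y = R̂ X` gives
`∫ (g ∘ R̂) |det DR̂|² ≤ 32 ∫ g`. The value `α = 3/11` corresponds to the exponent `-3/4`.
Everything takes place on the shell `1 < ‖X‖ < 2` of `ℂ³` with Lebesgue measure: for functions that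
are constant along rays, integrals over the shell, over balls and over the sphere are proportional.

* For the change of variables, `R̂` is the squaring of symmetric `2 × 2` matrices followed by the
  squaring of coordinates. By Cayley–Hamilton the first map has at most `4` preimages off its
  critical set, and the second has at most `8`.
* The Jacobian of `R̂` is `32 V (U + W)² (U² + V²) (V² + W²) (U W - V²)`. The exponent `-3/4` is
  critical for none of its factors, so only the points of `ℂℙ²` where several branches meet matter:
  the superattracting fixed points `[1 : 0 : 0]` and `[0 : 0 : 1]`, on four transversal branches
  (`cuspBound`), and the points of indeterminacy, on five branches counted with multiplicity, one
  of them double (`indetBound`). At both kinds of points, integrability is proved by integrating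
  out one coordinate at a time, after separating the poles.

The first step of the iteration needs the integrability of `1 / ‖σ_Y‖`, which is that of the modulus
of the reciprocal of a non-zero linear form.
-/

noncomputable section

namespace MigdalKadanoff

open scoped ENNReal NNReal

/-! ### Integration in polar coordinates and along finite-to-one maps -/

/-- Polar coordinates for a function that is constant along rays. -/
theorem lintegral_of_constant_on_rays {E : Type*} [NormedAddCommGroup E] [NormedSpace ℝ E]
    [MeasurableSpace E] [BorelSpace E] [FiniteDimensional ℝ E] [Nontrivial E]
    (μ : Measure E) [μ.IsAddHaarMeasure] {G : E → ℝ≥0∞} (hG : Measurable G)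
    (hom : ∀ (r : ℝ) (x : E), 0 < r → G (r • x) = G x) {T : Set ℝ} (hT : MeasurableSet T) :
    ∫⁻ x in {x | ‖x‖ ∈ T}, G x ∂μ =
      (∫⁻ v : Metric.sphere (0 : E) 1, G v ∂μ.toSphere) *
        Measure.volumeIoiPow (Module.finrank ℝ E - 1) (Subtype.val ⁻¹' T) := by
  have hTn : MeasurableSet {x : E | ‖x‖ ∈ T} := measurable_norm hT
  have h0 : MeasurableSet ({0}ᶜ : Set E) := (measurableSet_singleton 0).compl
  have hTs : MeasurableSet (Subtype.val ⁻¹' T : Set (Set.Ioi (0 : ℝ))) := measurable_subtype_coe hT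
  calc ∫⁻ x in {x | ‖x‖ ∈ T}, G x ∂μ
      = ∫⁻ x in ({0}ᶜ : Set E), ({x : E | ‖x‖ ∈ T}).indicator G x ∂μ := by
        rw [← lintegral_indicator hTn, restrict_compl_singleton]
    _ = ∫⁻ x : ({0}ᶜ : Set E), ({x : E | ‖x‖ ∈ T}).indicator G x ∂(μ.comap (↑)) :=
        (lintegral_subtype_comap h0 _).symm
    _ = ∫⁻ x : ({0}ᶜ : Set E), G (homeomorphUnitSphereProd E x).1 *
          (Subtype.val ⁻¹' T).indicator 1 (homeomorphUnitSphereProd E x).2 ∂(μ.comap (↑)) := by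
        refine lintegral_congr fun x => ?_
        have hx : 0 < ‖(x : E)‖ := norm_pos_iff.2 x.2
        have h1 : G (homeomorphUnitSphereProd E x).1 = G x := by
          simpa using hom ‖(x : E)‖⁻¹ x (by positivity)
        rw [h1]
        by_cases h : ‖(x : E)‖ ∈ T <;> simp [Set.indicator, h]
    _ = ∫⁻ p : Metric.sphere (0 : E) 1 × Set.Ioi (0 : ℝ), G p.1 *
          (Subtype.val ⁻¹' T).indicator 1 p.2
          ∂(μ.toSphere.prod (Measure.volumeIoiPow (Module.finrank ℝ E - 1))) := by
        refine μ.measurePreserving_homeomorphUnitSphereProd.lintegral_comp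
          (f := fun p => G p.1 * (Subtype.val ⁻¹' T).indicator 1 p.2) ?_
        exact ((hG.comp measurable_subtype_coe).comp measurable_fst).mul
          ((measurable_one.indicator hTs).comp measurable_snd)
    _ = _ := by
        rw [lintegral_prod_mul (f := fun v : Metric.sphere (0 : E) 1 => G v)
          (hG.comp measurable_subtype_coe).aemeasurable
          (measurable_one.indicator hTs).aemeasurable, lintegral_indicator_one hTs]

/-- A one-sided area formula for maps with at most `N` preimages: where the derivative is
invertible the map is locally injective, so countably many injective pieces suffice, and a point of
the target lies in the images of at most `N` of them. -/
theorem lintegral_comp_mul_abs_det_le {E : Type*} [NormedAddCommGroup E] [NormedSpace ℝ E]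
    [MeasurableSpace E] [BorelSpace E] [FiniteDimensional ℝ E]
    (μ : Measure E) [μ.IsAddHaarMeasure] {f : E → E} {f' : E → E →L[ℝ] E} {s : Set E}
    (hs : MeasurableSet s) (hf : ∀ x ∈ s, HasStrictFDerivAt f (f' x) x)
    (hdet : ∀ x ∈ s, (f' x).det ≠ 0) {N : ℕ}
    (hN : ∀ y, (s ∩ f ⁻¹' {y}).encard ≤ N) {g : E → ℝ≥0∞} (hg : Measurable g) {t : Set E}
    (ht : MeasurableSet t) (hst : Set.MapsTo f s t) :
    ∫⁻ x in s, ENNReal.ofReal |(f' x).det| * g (f x) ∂μ ≤ N * ∫⁻ y in t, g y ∂μ := by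
  have : CompleteSpace E := FiniteDimensional.complete ℝ E
  have hloc : ∀ x ∈ s, ∃ u, IsOpen u ∧ x ∈ u ∧ Set.InjOn f u := fun x hx => by
    let e := (f' x).toContinuousLinearEquivOfDetNeZero (hdet x hx)
    have h : HasStrictFDerivAt f (e : E →L[ℝ] E) x := hf x hx
    exact ⟨_, (h.toOpenPartialHomeomorph f).open_source,
      h.mem_toOpenPartialHomeomorph_source, (h.toOpenPartialHomeomorph f).injOn⟩
  choose! u huo hxu hinj using hloc
  obtain ⟨c, hcs, hc, hcov⟩ := TopologicalSpace.countable_cover_nhdsWithin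
    (f := u) (s := s) fun x hx => mem_nhdsWithin_of_mem_nhds ((huo x hx).mem_nhds (hxu x hx))
  rcases c.eq_empty_or_nonempty with rfl | hne
  · have : s = ∅ := by simpa using hcov
    simp [this]
  obtain ⟨e, rfl⟩ := hc.exists_eq_range hne
  have hes : ∀ i, e i ∈ s := fun i => hcs ⟨i, rfl⟩
  let A : ℕ → Set E := fun i => s ∩ disjointed (fun j => u (e j)) i
  have hAm : ∀ i, MeasurableSet (A i) := fun i =>
    hs.inter (MeasurableSet.disjointed (fun j => (huo _ (hes j)).measurableSet) i)
  have hAs : ⋃ i, A i = s := by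
    rw [← Set.inter_iUnion, iUnion_disjointed, Set.inter_eq_left]
    simpa using hcov
  have hAd : Pairwise (Function.onFun Disjoint A) := fun i j hij =>
    (disjoint_disjointed (fun j => u (e j)) hij).mono Set.inter_subset_right Set.inter_subset_right
  have hAi : ∀ i, Set.InjOn f (A i) := fun i =>
    (hinj _ (hes i)).mono (Set.inter_subset_right.trans (disjointed_subset _ i))
  have hfd : ∀ i, ∀ x ∈ A i, HasFDerivWithinAt f (f' x) (A i) x := fun i x hx =>
    (hf x hx.1).hasFDerivAt.hasFDerivWithinAt
  have himg : ∀ i, MeasurableSet (f '' A i) := fun i =>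
    measurable_image_of_fderivWithin (hAm i) (hfd i) (hAi i)
  have hcount : ∀ y, ∑' i, (f '' A i).indicator (1 : E → ℝ≥0∞) y ≤
      t.indicator (fun _ => (N : ℝ≥0∞)) y := by
    intro y
    by_cases hy : y ∈ t
    · rw [Set.indicator_of_mem hy, ENNReal.tsum_eq_iSup_sum]
      refine iSup_le fun F => ?_
      classical
      have h1 : ∑ i ∈ F, (f '' A i).indicator (1 : E → ℝ≥0∞) y
          = ((F.filter fun i => y ∈ f '' A i).card : ℝ≥0∞) := by
        simp [Set.indicator_apply]
      rw [h1]
      have hex : ∀ i ∈ F.filter (fun i => y ∈ f '' A i), ∃ x ∈ A i, f x = y := fun i hi =>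
        (Finset.mem_filter.1 hi).2
      choose! x hxA hxy using hex
      have hle : ((F.filter fun i => y ∈ f '' A i : Finset ℕ) : Set ℕ).encard
          ≤ (s ∩ f ⁻¹' {y}).encard := by
        refine Set.encard_le_encard_of_injOn (f := x) (fun i hi => ?_) fun i hi j hj hij => ?_
        · exact ⟨(hxA i hi).1, hxy i hi⟩
        · by_contra hne
          exact (hAd hne).le_bot ⟨hxA i hi, hij ▸ hxA j hj⟩
      have := hle.trans (hN y)
      rw [Set.encard_coe_eq_coe_finsetCard] at this
      exact_mod_cast this
    · rw [Set.indicator_of_notMem hy, nonpos_iff_eq_zero, ENNReal.tsum_eq_zero]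
      intro i
      refine Set.indicator_of_notMem ?_ _
      rintro ⟨x, hx, rfl⟩
      exact hy (hst hx.1)
  calc ∫⁻ x in s, ENNReal.ofReal |(f' x).det| * g (f x) ∂μ
      = ∑' i, ∫⁻ x in A i, ENNReal.ofReal |(f' x).det| * g (f x) ∂μ := by
        conv_lhs => rw [← hAs]
        exact lintegral_iUnion hAm hAd _
    _ = ∑' i, ∫⁻ y, (f '' A i).indicator g y ∂μ := by
        refine tsum_congr fun i => ?_
        rw [← lintegral_image_eq_lintegral_abs_det_fderiv_mul μ (hAm i) (hfd i) (hAi i),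
          lintegral_indicator (himg i)]
    _ = ∫⁻ y, ∑' i, (f '' A i).indicator g y ∂μ :=
        (lintegral_tsum fun i => (hg.indicator (himg i)).aemeasurable).symm
    _ ≤ ∫⁻ y, t.indicator (fun y => N * g y) y ∂μ := by
        refine lintegral_mono fun y => ?_
        have h1 : ∀ i, (f '' A i).indicator g y = (f '' A i).indicator 1 y * g y := fun i => by
          by_cases h : y ∈ f '' A i
          · rw [Set.indicator_of_mem h, Set.indicator_of_mem h, Pi.one_apply, one_mul]
          · rw [Set.indicator_of_notMem h, Set.indicator_of_notMem h, zero_mul]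
        beta_reduce
        rw [tsum_congr h1, ENNReal.tsum_mul_right]
        refine (mul_le_mul_left (hcount y) _).trans_eq ?_
        by_cases hy : y ∈ t <;> simp [hy]
    _ = N * ∫⁻ y in t, g y ∂μ := by
        rw [lintegral_indicator ht, lintegral_const_mul _ hg]

/-! ### The factorization of the renormalization map -/

/-- Writing a point of `ℂ³` as the symmetric matrix with rows `(U, V)` and `(V, W)`, this is
the squaring of matrices. -/
def matSq (X : C3) : C3 :=
  !₂[X 0 ^ 2 + X 1 ^ 2, X 1 * (X 0 + X 2), X 1 ^ 2 + X 2 ^ 2]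

/-- The squaring of each coordinate. -/
def coordSq (X : C3) : C3 := !₂[X 0 ^ 2, X 1 ^ 2, X 2 ^ 2]

theorem RHat_eq_coordSq_matSq (X : C3) : RHat X = coordSq (matSq X) := by
  ext i
  fin_cases i <;> simp [RHat, coordSq, matSq, mul_pow]

/-- The complex Jacobian determinant of `matSq`. -/
def matSqJac (X : C3) : ℂ := 4 * ((X 0 + X 2) * (X 0 * X 2 - X 1 ^ 2))

/-- The complex Jacobian determinant of `coordSq`. -/
def coordSqJac (X : C3) : ℂ := 8 * (X 0 * X 1 * X 2)

/-- The complex Jacobian determinant of `RHat`, by the chain rule. -/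
def RHatJac (X : C3) : ℂ := coordSqJac (matSq X) * matSqJac X

@[fun_prop]
theorem continuous_matSq : Continuous matSq := by
  unfold matSq; fun_prop

@[fun_prop]
theorem continuous_coordSq : Continuous coordSq := by
  unfold coordSq; fun_prop

theorem continuous_RHat : Continuous RHat := by
  unfold RHat; fun_prop

@[fun_prop]
theorem continuous_matSqJac : Continuous matSqJac := by
  unfold matSqJac; fun_prop

@[fun_prop]
theorem continuous_coordSqJac : Continuous coordSqJac := by
  unfold coordSqJac; fun_prop

theorem continuous_RHatJac : Continuous RHatJac := by
  unfold RHatJac; fun_prop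

theorem hasStrictFDerivAt_of_coord {f : C3 → C3} {M : Matrix (Fin 3) (Fin 3) ℂ} {X : C3}
    (h : ∀ i, HasStrictFDerivAt (fun X => f X i)
      (M i 0 • EuclideanSpace.proj 0 + M i 1 • EuclideanSpace.proj 1 +
        M i 2 • EuclideanSpace.proj 2 : C3 →L[ℂ] ℂ) X) :
    HasStrictFDerivAt f ((Matrix.toEuclideanCLM (𝕜 := ℂ) M).restrictScalars ℝ) X := by
  refine HasStrictFDerivAt.restrictScalars ℝ ?_
  rw [hasStrictFDerivAt_euclidean]
  intro i
  refine (h i).congr_fderiv ?_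
  ext v
  change M i 0 * v 0 + M i 1 * v 1 + M i 2 * v 2 = ∑ j, M i j * v j
  rw [Fin.sum_univ_three]

/-- The real determinant of a complex matrix is the squared modulus of the complex one. -/
theorem abs_det_restrictScalars (M : Matrix (Fin 3) (Fin 3) ℂ) :
    |((Matrix.toEuclideanCLM (𝕜 := ℂ) M).restrictScalars ℝ).det| = ‖M.det‖ ^ 2 := by
  have h1 : LinearMap.det ((Matrix.toEuclideanCLM (𝕜 := ℂ) M : C3 →L[ℂ] C3) : C3 →ₗ[ℂ] C3)
      = M.det := by
    change LinearMap.det (Matrix.toLpLin 2 2 M) = _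
    rw [Matrix.toLpLin_eq_toLin, LinearMap.det_toLin]
  have h2 : ((Matrix.toEuclideanCLM (𝕜 := ℂ) M).restrictScalars ℝ).det =
      Algebra.norm ℝ M.det := by
    rw [← h1]
    exact LinearMap.det_restrictScalars
  rw [h2, Algebra.norm_complex_apply, Complex.normSq_eq_norm_sq, abs_of_nonneg (by positivity)]

/-- The matrix of the derivative of `matSq`. -/
def matSqDeriv (X : C3) : Matrix (Fin 3) (Fin 3) ℂ :=
  !![2 * X 0, 2 * X 1, 0; X 1, X 0 + X 2, X 1; 0, 2 * X 1, 2 * X 2]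

/-- The matrix of the derivative of `coordSq`. -/
def coordSqDeriv (X : C3) : Matrix (Fin 3) (Fin 3) ℂ :=
  !![2 * X 0, 0, 0; 0, 2 * X 1, 0; 0, 0, 2 * X 2]

theorem det_matSqDeriv (X : C3) : (matSqDeriv X).det = matSqJac X := by
  simp [matSqDeriv, matSqJac, Matrix.det_fin_three]; ring

theorem det_coordSqDeriv (X : C3) : (coordSqDeriv X).det = coordSqJac X := by
  simp [coordSqDeriv, coordSqJac, Matrix.det_fin_three]; ring

theorem hasStrictFDerivAt_coord (i : Fin 3) (X : C3) :
    HasStrictFDerivAt (fun X : C3 => X i) (EuclideanSpace.proj i : C3 →L[ℂ] ℂ) X :=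
  (EuclideanSpace.proj i : C3 →L[ℂ] ℂ).hasStrictFDerivAt

theorem hasStrictFDerivAt_matSq (X : C3) :
    HasStrictFDerivAt matSq ((Matrix.toEuclideanCLM (𝕜 := ℂ) (matSqDeriv X)).restrictScalars ℝ)
      X := by
  have h0 := hasStrictFDerivAt_coord 0 X
  have h1 := hasStrictFDerivAt_coord 1 X
  have h2 := hasStrictFDerivAt_coord 2 X
  refine hasStrictFDerivAt_of_coord fun i => ?_
  fin_cases i
  · refine ((h0.pow 2).add (h1.pow 2)).congr_fderiv ?_
    ext v; simp [matSqDeriv]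
  · refine (h1.mul (h0.add h2)).congr_fderiv ?_
    ext v; simp [matSqDeriv]; ring
  · refine ((h1.pow 2).add (h2.pow 2)).congr_fderiv ?_
    ext v; simp [matSqDeriv]

theorem hasStrictFDerivAt_coordSq (X : C3) :
    HasStrictFDerivAt coordSq
      ((Matrix.toEuclideanCLM (𝕜 := ℂ) (coordSqDeriv X)).restrictScalars ℝ) X := by
  refine hasStrictFDerivAt_of_coord fun i => ?_
  fin_cases i
  · refine ((hasStrictFDerivAt_coord 0 X).pow 2).congr_fderiv ?_
    ext v; simp [coordSqDeriv]
  · refine ((hasStrictFDerivAt_coord 1 X).pow 2).congr_fderiv ?_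
    ext v; simp [coordSqDeriv]
  · refine ((hasStrictFDerivAt_coord 2 X).pow 2).congr_fderiv ?_
    ext v; simp [coordSqDeriv]

theorem encard_fiber_coordSq_le (Y : C3) : (coordSq ⁻¹' {Y}).encard ≤ (8 : ℕ) := by
  obtain ⟨a, ha⟩ := IsAlgClosed.exists_pow_nat_eq (Y 0) two_pos
  obtain ⟨b, hb⟩ := IsAlgClosed.exists_pow_nat_eq (Y 1) two_pos
  obtain ⟨c, hc⟩ := IsAlgClosed.exists_pow_nat_eq (Y 2) two_pos
  classical
  let F : Finset C3 := (({a, -a} : Finset ℂ) ×ˢ ({b, -b} : Finset ℂ) ×ˢ ({c, -c} : Finset ℂ)).image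
    fun t => !₂[t.1, t.2.1, t.2.2]
  have hF : F.card ≤ 8 := by
    refine Finset.card_image_le.trans ?_
    rw [Finset.card_product, Finset.card_product]
    calc _ ≤ 2 * (2 * 2) := by gcongr <;> exact Finset.card_le_two
      _ = 8 := by norm_num
  have hsub : coordSq ⁻¹' {Y} ⊆ F := by
    rintro X rfl
    simp only [coordSq, PiLp.toLp_apply, Matrix.cons_val, sq_eq_sq_iff_eq_or_eq_neg] at ha hb hc
    simp only [F, Finset.coe_image, Set.mem_image, Finset.mem_coe, Finset.mem_product,
      Finset.mem_insert, Finset.mem_singleton]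
    refine ⟨(X 0, X 1, X 2), ⟨?_, ?_, ?_⟩, ?_⟩
    · rcases ha with h | h <;> simp [h]
    · rcases hb with h | h <;> simp [h]
    · rcases hc with h | h <;> simp [h]
    · ext i; fin_cases i <;> rfl
  refine (Set.encard_le_encard hsub).trans ?_
  rw [Set.encard_coe_eq_coe_finsetCard]
  exact_mod_cast hF

/-- By the Cayley–Hamilton identity `M² = t M - d`, a matrix `M` with trace `t ≠ 0` and
determinant `d` is determined by `M²`, `t` and `d`; and `d² = det M²`, `t² = tr M² + 2 d`. -/
theorem encard_fiber_matSq_le (Y : C3) :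
    ({X | matSqJac X ≠ 0} ∩ matSq ⁻¹' {Y}).encard ≤ (4 : ℕ) := by
  obtain ⟨d, hd⟩ := IsAlgClosed.exists_pow_nat_eq (Y 0 * Y 2 - Y 1 ^ 2) two_pos
  obtain ⟨a, ha⟩ := IsAlgClosed.exists_pow_nat_eq (Y 0 + Y 2 + 2 * d) two_pos
  obtain ⟨b, hb⟩ := IsAlgClosed.exists_pow_nat_eq (Y 0 + Y 2 - 2 * d) two_pos
  classical
  let F : Finset C3 := ({(d, a), (d, -a), (-d, b), (-d, -b)} : Finset (ℂ × ℂ)).image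
    fun p => !₂[(Y 0 + p.1) / p.2, Y 1 / p.2, (Y 2 + p.1) / p.2]
  have hF : F.card ≤ 4 := Finset.card_image_le.trans Finset.card_le_four
  have hsub : {X | matSqJac X ≠ 0} ∩ matSq ⁻¹' {Y} ⊆ F := by
    rintro X ⟨hX, rfl⟩
    have ht : X 0 + X 2 ≠ 0 := fun h => hX (by simp [matSqJac, h])
    simp only [matSq, PiLp.toLp_apply, Matrix.cons_val] at hd ha hb
    have hd' : d = X 0 * X 2 - X 1 ^ 2 ∨ d = -(X 0 * X 2 - X 1 ^ 2) := by
      rw [← sq_eq_sq_iff_eq_or_eq_neg, hd]; ring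
    simp only [F, Finset.coe_image, Set.mem_image, Finset.mem_coe, Finset.mem_insert,
      Finset.mem_singleton]
    refine ⟨(X 0 * X 2 - X 1 ^ 2, X 0 + X 2), ?_, ?_⟩
    · rcases hd' with h | h
      · have : a = X 0 + X 2 ∨ a = -(X 0 + X 2) := by
          rw [← sq_eq_sq_iff_eq_or_eq_neg, ha, h]; ring
        rcases this with h' | h' <;> simp [h, h']
      · have : b = X 0 + X 2 ∨ b = -(X 0 + X 2) := by
          rw [← sq_eq_sq_iff_eq_or_eq_neg, hb, h]; ring
        rcases this with h' | h' <;> simp [h, h']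
    · ext i
      fin_cases i
      all_goals simp [matSq]; field_simp
      ring
  refine (Set.encard_le_encard hsub).trans ?_
  rw [Set.encard_coe_eq_coe_finsetCard]
  exact_mod_cast hF

/-- The change of variables `Y = R̂ X`, with the bound `32 = 4 · 8` on the number of preimages. -/
theorem lintegral_comp_RHat_le {g : C3 → ℝ≥0∞} (hg : Measurable g) {s t : Set C3}
    (hs : MeasurableSet s) (ht : MeasurableSet t) (hst : Set.MapsTo RHat s t) :
    ∫⁻ X in s, ‖RHatJac X‖ₑ ^ 2 * g (RHat X) ∂Measure.addHaar ≤
      32 * ∫⁻ Y in t, g Y ∂Measure.addHaar := by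
  have hof : ∀ z : ℂ, ENNReal.ofReal (‖z‖ ^ 2) = ‖z‖ₑ ^ 2 := fun z => by
    rw [ENNReal.ofReal_pow (norm_nonneg _), ofReal_norm]
  let T : Set C3 := coordSq ⁻¹' t
  have hT : MeasurableSet T := continuous_coordSq.measurable ht
  have hS := lintegral_comp_mul_abs_det_le (Measure.addHaar : Measure C3) (f := coordSq)
    (s := T ∩ {X | coordSqJac X ≠ 0}) (N := 8) (t := t) (g := g)
    (hT.inter (isOpen_ne_fun (by fun_prop) continuous_const).measurableSet)
    (fun X _ => hasStrictFDerivAt_coordSq X)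
    (fun X hX => by
      rw [← abs_ne_zero, abs_det_restrictScalars, det_coordSqDeriv]
      simpa using hX.2)
    (fun Y => (Set.encard_le_encard Set.inter_subset_right).trans (encard_fiber_coordSq_le Y))
    hg ht (fun X hX => hX.1)
  have hQ := lintegral_comp_mul_abs_det_le (Measure.addHaar : Measure C3) (f := matSq)
    (s := s ∩ {X | RHatJac X ≠ 0}) (N := 4) (t := T ∩ {X | coordSqJac X ≠ 0})
    (g := fun X => ‖coordSqJac X‖ₑ ^ 2 * g (coordSq X))
    (hs.inter (isOpen_ne_fun continuous_RHatJac continuous_const).measurableSet)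
    (fun X _ => hasStrictFDerivAt_matSq X)
    (fun X hX => by
      rw [← abs_ne_zero, abs_det_restrictScalars, det_matSqDeriv]
      simpa using (mul_ne_zero_iff.1 hX.2).2)
    (fun Y => (Set.encard_le_encard (Set.inter_subset_inter_left _ fun X hX =>
      (mul_ne_zero_iff.1 hX.2).2)).trans (encard_fiber_matSq_le Y))
    ((continuous_coordSqJac.measurable.enorm.pow_const 2).mul
      (hg.comp continuous_coordSq.measurable))
    (hT.inter (isOpen_ne_fun (by fun_prop) continuous_const).measurableSet)
    (fun X hX => ⟨by
      change coordSq (matSq X) ∈ t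
      rw [← RHat_eq_coordSq_matSq]; exact hst hX.1, (mul_ne_zero_iff.1 hX.2).1⟩)
  simp only [abs_det_restrictScalars, det_coordSqDeriv, det_matSqDeriv, hof] at hS hQ
  calc ∫⁻ X in s, ‖RHatJac X‖ₑ ^ 2 * g (RHat X) ∂Measure.addHaar
      = ∫⁻ X in s ∩ {X | RHatJac X ≠ 0}, ‖RHatJac X‖ₑ ^ 2 * g (RHat X) ∂Measure.addHaar := by
        have hm : MeasurableSet {X | RHatJac X ≠ 0} :=
          (isOpen_ne_fun continuous_RHatJac continuous_const).measurableSet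
        rw [Set.inter_comm, ← setLIntegral_indicator hm]
        refine lintegral_congr fun X => ?_
        by_cases h : RHatJac X = 0 <;> simp [h]
    _ = ∫⁻ X in s ∩ {X | RHatJac X ≠ 0}, ‖matSqJac X‖ₑ ^ 2 *
          (‖coordSqJac (matSq X)‖ₑ ^ 2 * g (coordSq (matSq X))) ∂Measure.addHaar := by
        refine lintegral_congr fun X => ?_
        rw [RHat_eq_coordSq_matSq, RHatJac, enorm_mul, mul_pow]
        ring
    _ ≤ (4 : ℕ) * ((8 : ℕ) * ∫⁻ Y in t, g Y ∂Measure.addHaar) := hQ.trans (by gcongr)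
    _ = 32 * ∫⁻ Y in t, g Y ∂Measure.addHaar := by
        rw [← mul_assoc]; norm_num

/-! ### Singular integrals -/

/-- The kernel `|z|⁻ᵉ` on `ℂ`, with the value `∞` at the origin for `e > 0`. -/
def riesz (e : ℝ) (z : ℂ) : ℝ≥0∞ := ‖z‖ₑ ^ (-e)

theorem measurable_riesz (e : ℝ) : Measurable (riesz e) :=
  measurable_enorm.pow_const _

@[fun_prop]
theorem measurable_riesz_comp {α : Type*} [MeasurableSpace α] {f : α → ℂ} (e : ℝ)
    (hf : Measurable f) : Measurable fun x => riesz e (f x) :=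
  (measurable_riesz e).comp hf

theorem riesz_anti {e : ℝ} (he : 0 ≤ e) {z w : ℂ} (h : ‖z‖ ≤ ‖w‖) : riesz e w ≤ riesz e z := by
  rw [riesz, riesz, ENNReal.rpow_neg, ENNReal.rpow_neg]
  have : ‖z‖ₑ ≤ ‖w‖ₑ := enorm_le_iff_norm_le.2 h
  gcongr

theorem riesz_mul (e : ℝ) (z w : ℂ) : riesz e (z * w) = riesz e z * riesz e w := by
  rw [riesz, enorm_mul, ENNReal.mul_rpow_of_ne_top enorm_ne_top enorm_ne_top, riesz, riesz]

theorem riesz_zero {e : ℝ} (he : 0 < e) : riesz e 0 = ∞ := by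
  rw [riesz, enorm_zero, ENNReal.zero_rpow_of_neg (by linarith)]

theorem riesz_add {a b : ℝ} (ha : 0 < a) (hb : 0 < b) (z : ℂ) :
    riesz a z * riesz b z = riesz (a + b) z := by
  by_cases hz : z = 0
  · subst hz
    rw [riesz_zero ha, riesz_zero hb, riesz_zero (by positivity), ENNReal.top_mul_top]
  · rw [riesz, riesz, riesz, ← ENNReal.rpow_add _ _ (by simpa using hz) enorm_ne_top, neg_add]

/-- The thresholds `1/64` and `4096 = 64²` only need to be generous enough for all uses below. -/
theorem riesz_le_of_le_norm {e : ℝ} (he : 0 ≤ e) (he2 : e ≤ 2) {z : ℂ} (h : 1 / 64 ≤ ‖z‖) :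
    riesz e z ≤ 4096 := by
  have h1 : riesz e z ≤ riesz e (1 / 64 : ℂ) := riesz_anti he (by simpa using h)
  refine h1.trans ?_
  have h2 : ‖(1 / 64 : ℂ)‖ₑ = (64 : ℝ≥0∞)⁻¹ := by
    rw [← ofReal_norm]
    have : ‖(1 / 64 : ℂ)‖ = (64 : ℝ)⁻¹ := by simp
    rw [this, ENNReal.ofReal_inv_of_pos (by norm_num)]; simp
  rw [riesz, h2, ENNReal.rpow_neg, ENNReal.inv_rpow, inv_inv]
  calc (64 : ℝ≥0∞) ^ e ≤ 64 ^ (2 : ℝ) := ENNReal.rpow_le_rpow_of_exponent_le (by norm_num) he2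
    _ = 4096 := by rw [ENNReal.rpow_two]; norm_num

theorem riesz_mul_le {a b : ℝ} (ha : 0 < a) (hb : 0 < b) (z w : ℂ) :
    riesz a z * riesz b w ≤ riesz (a + b) z + riesz (a + b) w := by
  rcases le_total ‖z‖ ‖w‖ with h | h
  · refine le_trans ?_ le_self_add
    rw [← riesz_add ha hb]
    gcongr
    exact riesz_anti hb.le h
  · refine le_trans ?_ le_add_self
    rw [← riesz_add ha hb]
    gcongr
    exact riesz_anti ha.le h

/-- Two poles at a distance at least `2 |d|`. -/
theorem riesz_mul_le_of_separated {a : ℝ} (ha : 0 ≤ a) {d z w : ℂ} (h : 2 * ‖d‖ ≤ ‖z‖ + ‖w‖) :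
    riesz a z * riesz a w ≤ riesz a d * (riesz a z + riesz a w) := by
  rcases le_total ‖z‖ ‖w‖ with h' | h'
  · calc riesz a z * riesz a w ≤ riesz a z * riesz a d := by
          gcongr; exact riesz_anti ha (by linarith)
      _ ≤ _ := by rw [mul_comm]; gcongr; exact le_self_add
  · calc riesz a z * riesz a w ≤ riesz a d * riesz a w := by
          gcongr; exact riesz_anti ha (by linarith)
      _ ≤ _ := by gcongr; exact le_add_self

/-- Partial fractions for `1 / |z² + v²|`. -/
theorem riesz_sq_add_sq_le {e : ℝ} (he : 0 ≤ e) (z v : ℂ) :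
    riesz e (z ^ 2 + v ^ 2) ≤
      riesz e v * (riesz e (z - Complex.I * v) + riesz e (z + Complex.I * v)) := by
  have hfac : z ^ 2 + v ^ 2 = (z - Complex.I * v) * (z + Complex.I * v) := by
    linear_combination v ^ 2 * Complex.I_sq
  rw [hfac, riesz_mul]
  refine riesz_mul_le_of_separated he ?_
  calc 2 * ‖v‖ = ‖(z + Complex.I * v) - (z - Complex.I * v)‖ := by
        rw [show (z + Complex.I * v) - (z - Complex.I * v) = 2 * (Complex.I * v) by ring,
          norm_mul]; simp
    _ ≤ _ := (norm_sub_le _ _).trans_eq (add_comm _ _)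

/-- Three poles, seen from a point that is closest to the first one. -/
theorem riesz_mul_mul_le_of_min {a b c k l : ℝ} (ha : 0 < a) (hb : 0 < b) (hc : 0 < c)
    (hk : 0 < k) (hl : 0 < l) (hkl : k + l = b + c) {d x y z : ℂ} (hxy : ‖x‖ ≤ ‖y‖)
    (hxz : ‖x‖ ≤ ‖z‖) (hdy : ‖d‖ ≤ ‖y‖) (hdz : ‖d‖ ≤ ‖z‖) :
    riesz a x * (riesz b y * riesz c z) ≤ riesz k d * riesz (a + l) x := by
  have key : ∀ w : ℂ, ‖x‖ ≤ ‖w‖ → ‖d‖ ≤ ‖w‖ → riesz (b + c) w ≤ riesz k d * riesz l x := by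
    intro w h1 h2
    rw [← hkl, ← riesz_add hk hl]
    gcongr
    exacts [riesz_anti hk.le h2, riesz_anti hl.le h1]
  have : riesz b y * riesz c z ≤ riesz k d * riesz l x := by
    rcases le_total ‖y‖ ‖z‖ with h | h
    · refine le_trans ?_ (key y hxy hdy)
      rw [← riesz_add hb hc]
      gcongr; exact riesz_anti hc.le h
    · refine le_trans ?_ (key z hxz hdz)
      rw [← riesz_add hb hc]
      gcongr; exact riesz_anti hb.le h
  calc _ ≤ riesz a x * (riesz k d * riesz l x) := by gcongr
    _ = riesz k d * (riesz a x * riesz l x) := by ring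
    _ = _ := by rw [riesz_add ha hl]

/-- Three poles at pairwise distances at least `2 |d|`: at the price of `|d|⁻ᵏ` the total
exponent can be lowered by `k`. -/
theorem riesz_mul_mul_le_of_separated {a b c k : ℝ} (ha : 0 < a) (hb : 0 < b) (hc : 0 < c)
    (hk : 0 < k) (hab : k < a + b) (hbc : k < b + c) (hac : k < a + c) {d x y z : ℂ}
    (hxy : 2 * ‖d‖ ≤ ‖x‖ + ‖y‖) (hyz : 2 * ‖d‖ ≤ ‖y‖ + ‖z‖) (hxz : 2 * ‖d‖ ≤ ‖x‖ + ‖z‖) :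
    riesz a x * (riesz b y * riesz c z) ≤ riesz k d *
      (riesz (a + b + c - k) x + riesz (a + b + c - k) y + riesz (a + b + c - k) z) := by
  by_cases hx : ‖x‖ ≤ ‖y‖ ∧ ‖x‖ ≤ ‖z‖
  · refine (riesz_mul_mul_le_of_min (l := b + c - k) ha hb hc hk (by linarith) (by ring)
      hx.1 hx.2 (d := d) (by linarith) (by linarith)).trans ?_
    rw [show a + (b + c - k) = a + b + c - k by ring]
    gcongr
    exact le_self_add.trans le_self_add
  by_cases hy : ‖y‖ ≤ ‖x‖ ∧ ‖y‖ ≤ ‖z‖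
  · have := (riesz_mul_mul_le_of_min (l := a + c - k) hb ha hc hk (by linarith) (by ring)
      hy.1 hy.2 (d := d) (by linarith) (by linarith))
    rw [show b + (a + c - k) = a + b + c - k by ring] at this
    rw [mul_left_comm]
    refine this.trans ?_
    gcongr
    exact le_add_self.trans le_self_add
  have hz : ‖z‖ ≤ ‖x‖ ∧ ‖z‖ ≤ ‖y‖ := by
    rcases le_total ‖x‖ ‖y‖ with h | h
    · have : ‖z‖ < ‖x‖ := by by_contra h'; exact hx ⟨h, not_lt.1 h'⟩
      exact ⟨this.le, this.le.trans h⟩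
    · have : ‖z‖ < ‖y‖ := by by_contra h'; exact hy ⟨h, not_lt.1 h'⟩
      exact ⟨this.le.trans h, this.le⟩
  have := (riesz_mul_mul_le_of_min (l := a + b - k) hc ha hb hk (by linarith) (by ring)
      hz.1 hz.2 (d := d) (by linarith) (by linarith))
  rw [show c + (a + b - k) = a + b + c - k by ring] at this
  rw [show riesz a x * (riesz b y * riesz c z) = riesz c z * (riesz a x * riesz b y) by ring]
  refine this.trans ?_
  gcongr
  exact le_add_self

/-- The disc that contains the coordinates of the points of norm less than `2`. -/
def disc : Set ℂ := Metric.ball 0 2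

theorem lintegral_disc_const_lt_top {c : ℝ≥0∞} (hc : c ≠ ∞) : ∫⁻ _ in disc, c < ∞ := by
  rw [setLIntegral_const]
  exact ENNReal.mul_lt_top hc.lt_top measure_ball_lt_top

theorem lintegral_riesz_ball_lt_top {e : ℝ} (he : e < 2) :
    ∫⁻ z in Metric.ball (0 : ℂ) 1, riesz e z < ∞ := by
  have h1 : IntegrableOn (fun y : ℝ => y ^ (1 - e)) (Set.Ioc 0 1) :=
    (intervalIntegral.intervalIntegrable_rpow' (by linarith)).1
  have h2 : Integrable (fun z : ℂ => (Set.Iio (1 : ℝ)).indicator (fun y => y ^ (-e)) ‖z‖) := by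
    rw [integrable_fun_norm_addHaar volume (E := ℂ)
      (f := (Set.Iio (1 : ℝ)).indicator (fun y => y ^ (-e)))]
    have h3 : IntegrableOn (fun y : ℝ => y ^ (1 - e)) (Set.Ioo 0 1) :=
      h1.mono_set Set.Ioo_subset_Ioc_self
    rw [← integrable_indicator_iff measurableSet_Ioo] at h3
    rw [← integrable_indicator_iff measurableSet_Ioi]
    refine h3.congr (Eventually.of_forall fun y => ?_)
    by_cases hy : 0 < y
    · by_cases hy1 : y < 1
      · simp only [Set.indicator, Set.mem_Ioo, Set.mem_Ioi, Set.mem_Iio, hy, hy1, and_self,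
          if_true, Complex.finrank_real_complex, smul_eq_mul]
        rw [sub_eq_add_neg, Real.rpow_add hy]; simp
      · simp [Set.indicator, hy, hy1]
    · simp [Set.indicator, hy]
  have h4 := h2.lintegral_lt_top
  refine lt_of_le_of_lt ?_ h4
  rw [← lintegral_indicator measurableSet_ball]
  refine lintegral_mono_ae ?_
  filter_upwards [compl_mem_ae_iff.2 (measure_singleton (0 : ℂ))] with z hz
  have hz' : 0 < ‖z‖ := norm_pos_iff.2 hz
  by_cases h : ‖z‖ < 1
  · simp [Set.indicator, h, riesz, ← ENNReal.ofReal_rpow_of_pos hz']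
  · simp [Set.indicator, h]

theorem exists_lintegral_riesz_sub_le {e : ℝ} (h0 : 0 ≤ e) (he : e < 2) :
    ∃ C : ℝ≥0∞, C ≠ ∞ ∧ ∀ a : ℂ, ∫⁻ z in disc, riesz e (z - a) ≤ C := by
  refine ⟨(∫⁻ z in Metric.ball (0 : ℂ) 1, riesz e z) + ∫⁻ _ in disc, 1,
    (ENNReal.add_lt_top.2 ⟨lintegral_riesz_ball_lt_top he,
      lintegral_disc_const_lt_top ENNReal.one_ne_top⟩).ne, fun a => ?_⟩
  have h1 : ∫⁻ z in Metric.ball (0 : ℂ) 1, riesz e z =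
      ∫⁻ z, (Metric.ball (0 : ℂ) 1).indicator (riesz e) (z - a) := by
    rw [lintegral_sub_right_eq_self (fun z => (Metric.ball (0 : ℂ) 1).indicator (riesz e) z) a,
      lintegral_indicator measurableSet_ball]
  rw [h1]
  calc ∫⁻ z in disc, riesz e (z - a)
      ≤ ∫⁻ z in disc, ((Metric.ball (0 : ℂ) 1).indicator (riesz e) (z - a) + 1) := by
        refine lintegral_mono fun z => ?_
        by_cases h : z - a ∈ Metric.ball (0 : ℂ) 1
        · simp [Set.indicator_of_mem h]
        · have h' : 1 ≤ ‖z - a‖ := by simpa using h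
          have := riesz_anti h0 (z := 1) (w := z - a) (by simpa using h')
          refine this.trans (le_trans ?_ le_add_self)
          simp [riesz]
    _ = (∫⁻ z in disc, (Metric.ball (0 : ℂ) 1).indicator (riesz e) (z - a)) + ∫⁻ _ in disc, 1 :=
        lintegral_add_right _ measurable_const
    _ ≤ _ := by
        gcongr
        exact Measure.restrict_le_self

theorem exists_lintegral_riesz_affine_le {e : ℝ} (h0 : 0 ≤ e) (he : e < 2) :
    ∃ C : ℝ≥0∞, C ≠ ∞ ∧ ∀ c a : ℂ, c ≠ 0 → ∫⁻ z in disc, riesz e (c * z - a) ≤ riesz e c * C := by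
  obtain ⟨C, hC, h⟩ := exists_lintegral_riesz_sub_le h0 he
  refine ⟨C, hC, fun c a hc => ?_⟩
  have h1 : ∀ z, riesz e (c * z - a) = riesz e c * riesz e (z - a / c) := fun z => by
    rw [← riesz_mul]; congr 1; field_simp
  simp_rw [h1]
  rw [lintegral_const_mul _ (by fun_prop)]
  gcongr
  exact h _

/-! ### Fubini's theorem on `ℂ³` -/

/-- The coordinates of `ℂ³` in the order given by a permutation. -/
def coordEquiv (σ : Equiv.Perm (Fin 3)) : C3 ≃L[ℝ] ℂ × ℂ × ℂ :=
  LinearEquiv.toContinuousLinearEquiv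
    { toFun := fun X => (X (σ 0), X (σ 1), X (σ 2))
      invFun := fun t => WithLp.toLp 2 fun i => ![t.1, t.2.1, t.2.2] (σ.symm i)
      map_add' := fun _ _ => rfl
      map_smul' := fun _ _ => rfl
      left_inv := fun X => by
        ext i
        obtain ⟨j, rfl⟩ := σ.surjective i
        fin_cases j <;> simp
      right_inv := fun t => by simp }

/-- The spherical shell `1 < ‖X‖ < 2` in `ℂ³`. -/
def shell : Set C3 := {X | ‖X‖ ∈ Set.Ioo (1 : ℝ) 2}

theorem measurableSet_shell : MeasurableSet shell := measurable_norm measurableSet_Ioo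

theorem mem_disc_of_mem_shell {X : C3} (h : X ∈ shell) (i : Fin 3) : X i ∈ disc := by
  rw [disc, mem_ball_zero_iff]
  exact (PiLp.norm_apply_le X i).trans_lt h.2

/-- Integrability over the shell from an iterated integral, in any order of the coordinates. -/
theorem lintegral_shell_lt_top (σ : Equiv.Perm (Fin 3)) {F : ℂ → ℂ → ℂ → ℝ≥0∞}
    (hF : Measurable fun t : ℂ × ℂ × ℂ => F t.1 t.2.1 t.2.2)
    (h : ∫⁻ a in disc, ∫⁻ b in disc, ∫⁻ c in disc, F a b c < ∞) :
    ∫⁻ X in shell, F (X (σ 0)) (X (σ 1)) (X (σ 2)) ∂Measure.addHaar < ∞ := by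
  have hd : MeasurableSet disc := measurableSet_ball
  have : ((Measure.addHaar : Measure C3).map (coordEquiv σ)).IsAddHaarMeasure :=
    (coordEquiv σ).isAddHaarMeasure_map _
  have : (volume : Measure (ℂ × ℂ × ℂ)).IsAddHaarMeasure := by
    have h2 : (volume : Measure (ℂ × ℂ)).IsAddHaarMeasure :=
      Measure.prod.instIsAddHaarMeasure volume volume
    exact Measure.prod.instIsAddHaarMeasure volume volume
  have hmap := Measure.isAddLeftInvariant_eq_smul
    ((Measure.addHaar : Measure C3).map (coordEquiv σ)) (volume : Measure (ℂ × ℂ × ℂ))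
  have hme : MeasurableEmbedding (coordEquiv σ) :=
    (coordEquiv σ).toHomeomorph.measurableEmbedding
  have hvol : ∫⁻ t in disc ×ˢ disc ×ˢ disc, F t.1 t.2.1 t.2.2 < ∞ := by
    rw [Measure.volume_eq_prod, Measure.volume_eq_prod, ← Measure.prod_restrict,
      ← Measure.prod_restrict, lintegral_prod _ hF.aemeasurable]
    refine lt_of_eq_of_lt (lintegral_congr fun a => ?_) h
    exact lintegral_prod _ (hF.comp measurable_prodMk_left).aemeasurable
  calc ∫⁻ X in shell, F (X (σ 0)) (X (σ 1)) (X (σ 2)) ∂Measure.addHaar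
      ≤ ∫⁻ X in coordEquiv σ ⁻¹' (disc ×ˢ disc ×ˢ disc),
          F (X (σ 0)) (X (σ 1)) (X (σ 2)) ∂Measure.addHaar :=
        lintegral_mono_set fun X hX =>
          ⟨mem_disc_of_mem_shell hX _, mem_disc_of_mem_shell hX _, mem_disc_of_mem_shell hX _⟩
    _ = ∫⁻ t in disc ×ˢ disc ×ˢ disc, F t.1 t.2.1 t.2.2
          ∂((Measure.addHaar : Measure C3).map (coordEquiv σ)) :=
        (setLIntegral_map (hd.prod (hd.prod hd)) hF (coordEquiv σ).continuous.measurable).symm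
    _ < ∞ := by
        rw [hmap, Measure.restrict_smul, lintegral_smul_measure]
        exact ENNReal.mul_lt_top ENNReal.coe_lt_top hvol

/-- One constant bounds the integrals of `|·|⁻ᵉ` over all translates of a disc and, with the
appropriate factor, over its affine images; for `c = 0` the bound reads `∞`. -/
theorem exists_lintegral_riesz_le {e : ℝ} (h0 : 0 < e) (he : e < 2) :
    ∃ C : ℝ≥0∞, C ≠ ∞ ∧ (∀ a : ℂ, ∫⁻ z in disc, riesz e (z - a) ≤ C) ∧
      (∀ a : ℂ, ∫⁻ z in disc, riesz e (z + a) ≤ C) ∧ (∫⁻ z in disc, riesz e z ≤ C) ∧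
      ∀ c a : ℂ, ∫⁻ z in disc, riesz e (c * z - a) ≤ riesz e c * C := by
  obtain ⟨C, hC, h⟩ := exists_lintegral_riesz_affine_le h0.le he
  have h1 : riesz e 1 = 1 := by simp [riesz]
  have hsub : ∀ a : ℂ, ∫⁻ z in disc, riesz e (z - a) ≤ C := fun a => by
    simpa [h1] using h 1 a one_ne_zero
  refine ⟨C + 1, by simpa using hC, fun a => (hsub a).trans le_self_add, fun a => ?_, ?_,
    fun c a => ?_⟩
  · simpa using (hsub (-a)).trans le_self_add
  · simpa using (hsub 0).trans le_self_add
  · by_cases hc : c = 0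
    · subst hc
      rw [riesz_zero h0, ENNReal.top_mul (by simp)]
      exact le_top
    · exact (h c a hc).trans (by gcongr; exact le_self_add)

/-! ### Negative moments of the Jacobian -/

theorem norm_le_norm_add_add (a b : ℂ) : ‖a‖ ≤ ‖a + b‖ + ‖b‖ := by
  simpa using norm_sub_le (a + b) b

/-- Dominates `|det DR̂| ^ (-3/4)`, up to a constant, where `|V| ≤ |U| / 2` and `|U|` is bounded
below: a region around `[1 : 0 : 0]`. -/
def cuspBound (U V W : ℂ) : ℝ≥0∞ :=
  riesz (3 / 4) V * riesz (3 / 2) (W + U) + riesz (3 / 2) V *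
    (riesz (3 / 2) (W - Complex.I * V) + riesz (3 / 2) (W + Complex.I * V) +
      2 * riesz (3 / 2) (U * W - V ^ 2))

/-- Dominates `|det DR̂| ^ (-3/4)`, up to a constant, where `|V|` is bounded below: a region around
the points of indeterminacy `[± i : 1 : ∓ i]`. -/
def indetBound (V W U : ℂ) : ℝ≥0∞ :=
  {V : ℂ | 1 / 4 ≤ ‖V‖}.indicator 1 V * (riesz (15 / 8) (W ^ 2 + V ^ 2) *
    (2 * riesz (15 / 8) (U + W) + 2 * riesz (15 / 8) (W * U - V ^ 2) +
      riesz (15 / 8) (U - Complex.I * V) + riesz (15 / 8) (U + Complex.I * V)))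

theorem measurable_cuspBound : Measurable fun t : ℂ × ℂ × ℂ => cuspBound t.1 t.2.1 t.2.2 := by
  unfold cuspBound; fun_prop

theorem measurable_indetBound : Measurable fun t : ℂ × ℂ × ℂ => indetBound t.1 t.2.1 t.2.2 := by
  unfold indetBound
  refine Measurable.mul ?_ (by fun_prop)
  exact (measurable_one.indicator (isClosed_le continuous_const continuous_norm).measurableSet).comp
    measurable_fst

theorem lintegral_cuspBound_lt_top :
    ∫⁻ U in disc, ∫⁻ V in disc, ∫⁻ W in disc, cuspBound U V W < ∞ := by
  obtain ⟨C, hC, hsub, hadd, hid, haff⟩ :=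
    exists_lintegral_riesz_le (e := 3 / 2) (by norm_num) (by norm_num)
  obtain ⟨C', hC', -, -, hid', -⟩ :=
    exists_lintegral_riesz_le (e := 3 / 4) (by norm_num) (by norm_num)
  have hW : ∀ U V : ℂ, ∫⁻ W in disc, cuspBound U V W ≤
      riesz (3 / 4) V * C + riesz (3 / 2) V * (C + C + 2 * (riesz (3 / 2) U * C)) := by
    intro U V
    unfold cuspBound
    rw [lintegral_add_left (by fun_prop), lintegral_const_mul _ (by fun_prop),
      lintegral_const_mul _ (by fun_prop), lintegral_add_left (by fun_prop),
      lintegral_add_left (by fun_prop), lintegral_const_mul _ (by fun_prop)]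
    gcongr
    exacts [hadd _, hsub _, hadd _, haff _ _]
  have hV : ∀ U : ℂ, ∫⁻ V in disc, ∫⁻ W in disc, cuspBound U V W ≤
      C' * C + C * (C + C + 2 * (riesz (3 / 2) U * C)) := by
    intro U
    refine (lintegral_mono (hW U)).trans ?_
    rw [lintegral_add_left (by fun_prop), lintegral_mul_const _ (by fun_prop),
      lintegral_mul_const _ (by fun_prop)]
    gcongr
  have hV' : ∀ U : ℂ, ∫⁻ V in disc, ∫⁻ W in disc, cuspBound U V W ≤
      (C' * C + C * (C + C)) + (2 * C * C) * riesz (3 / 2) U := fun U =>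
    (hV U).trans_eq (by ring)
  refine (lintegral_mono hV').trans_lt ?_
  rw [lintegral_add_left measurable_const, lintegral_const_mul _ (by fun_prop)]
  have h1 : ∫⁻ U in disc, riesz (3 / 2) U ≠ ∞ := ne_top_of_le_ne_top hC hid
  have h2 := (lintegral_disc_const_lt_top (c := C' * C + C * (C + C)) (by finiteness)).ne
  finiteness

theorem lintegral_indetBound_lt_top :
    ∫⁻ V in disc, ∫⁻ W in disc, ∫⁻ U in disc, indetBound V W U < ∞ := by
  obtain ⟨C, hC, hsub, hadd, hid, haff⟩ :=
    exists_lintegral_riesz_le (e := 15 / 8) (by norm_num) (by norm_num)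
  have hU : ∀ V W : ℂ, ∫⁻ U in disc, indetBound V W U ≤
      {V : ℂ | 1 / 4 ≤ ‖V‖}.indicator 1 V * (riesz (15 / 8) (W ^ 2 + V ^ 2) *
        (2 * C + 2 * (riesz (15 / 8) W * C) + C + C)) := by
    intro V W
    unfold indetBound
    rw [lintegral_const_mul _ (by fun_prop), lintegral_const_mul _ (by fun_prop),
      lintegral_add_left (by fun_prop), lintegral_add_left (by fun_prop),
      lintegral_add_left (by fun_prop), lintegral_const_mul _ (by fun_prop),
      lintegral_const_mul _ (by fun_prop)]
    gcongr
    exacts [hadd _, haff _ _, hsub _, hadd _]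
  let K : ℝ≥0∞ := 4096 * (4 * C * (C + C) + 2 * C * (4096 * (C + C) + 4096 * (C + C)))
  have hWV : ∀ V : ℂ, ∫⁻ W in disc, ∫⁻ U in disc, indetBound V W U ≤ K := by
    intro V
    refine (lintegral_mono (hU V)).trans ?_
    by_cases hV : 1 / 4 ≤ ‖V‖
    swap
    · have : V ∉ {V : ℂ | 1 / 4 ≤ ‖V‖} := hV
      simp only [Set.indicator_of_notMem this, zero_mul, lintegral_zero, zero_le]
    have hV' : V ∈ {V : ℂ | 1 / 4 ≤ ‖V‖} := hV
    simp only [Set.indicator_of_mem hV', Pi.one_apply, one_mul]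
    have hVn : riesz (15 / 8) V ≤ 4096 :=
      riesz_le_of_le_norm (by norm_num) (by norm_num) (by linarith)
    have hV2 : riesz (15 / 8) (V / 2) ≤ 4096 :=
      riesz_le_of_le_norm (by norm_num) (by norm_num) (by simp; linarith)
    have hIV : ‖Complex.I * V‖ = ‖V‖ := by simp
    -- For `|V| ≥ 1/4` the poles `W = 0` and `W = ± i V` are well separated.
    have key : ∀ W : ℂ, riesz (15 / 8) (W ^ 2 + V ^ 2) *
        (2 * C + 2 * (riesz (15 / 8) W * C) + C + C) ≤
        4096 * (4 * C * (riesz (15 / 8) (W - Complex.I * V) + riesz (15 / 8) (W + Complex.I * V)) +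
          2 * C * (4096 * (riesz (15 / 8) W + riesz (15 / 8) (W - Complex.I * V)) +
            4096 * (riesz (15 / 8) W + riesz (15 / 8) (W + Complex.I * V)))) := by
      intro W
      have h1 : riesz (15 / 8) (W ^ 2 + V ^ 2) ≤
          4096 * (riesz (15 / 8) (W - Complex.I * V) + riesz (15 / 8) (W + Complex.I * V)) :=
        (riesz_sq_add_sq_le (by norm_num) W V).trans (by gcongr)
      have h2 : riesz (15 / 8) W * riesz (15 / 8) (W - Complex.I * V) ≤
          4096 * (riesz (15 / 8) W + riesz (15 / 8) (W - Complex.I * V)) := by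
        refine (riesz_mul_le_of_separated (d := V / 2) (by norm_num) ?_).trans (by gcongr)
        calc 2 * ‖V / 2‖ = ‖W - (W - Complex.I * V)‖ := by
              rw [sub_sub_cancel, hIV]; simp; ring
          _ ≤ _ := norm_sub_le _ _
      have h3 : riesz (15 / 8) W * riesz (15 / 8) (W + Complex.I * V) ≤
          4096 * (riesz (15 / 8) W + riesz (15 / 8) (W + Complex.I * V)) := by
        refine (riesz_mul_le_of_separated (d := V / 2) (by norm_num) ?_).trans (by gcongr)
        calc 2 * ‖V / 2‖ = ‖(W + Complex.I * V) - W‖ := by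
              rw [add_sub_cancel_left, hIV]; simp; ring
          _ ≤ _ := (norm_sub_le _ _).trans_eq (add_comm _ _)
      calc _ ≤ 4096 * (riesz (15 / 8) (W - Complex.I * V) + riesz (15 / 8) (W + Complex.I * V)) *
            (2 * C + 2 * (riesz (15 / 8) W * C) + C + C) := by gcongr
        _ = 4096 * (4 * C * (riesz (15 / 8) (W - Complex.I * V) +
              riesz (15 / 8) (W + Complex.I * V)) +
            2 * C * (riesz (15 / 8) W * riesz (15 / 8) (W - Complex.I * V) +
              riesz (15 / 8) W * riesz (15 / 8) (W + Complex.I * V))) := by ring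
        _ ≤ _ := by gcongr
    refine (lintegral_mono key).trans ?_
    rw [lintegral_const_mul _ (by fun_prop), lintegral_add_left (by fun_prop),
      lintegral_const_mul _ (by fun_prop), lintegral_const_mul _ (by fun_prop),
      lintegral_add_left (by fun_prop), lintegral_add_left (by fun_prop),
      lintegral_const_mul _ (by fun_prop), lintegral_const_mul _ (by fun_prop),
      lintegral_add_left (by fun_prop), lintegral_add_left (by fun_prop)]
    simp only [K]
    gcongr
    exacts [hsub _, hadd _, hsub _, hadd _]
  refine (lintegral_mono hWV).trans_lt (lintegral_disc_const_lt_top ?_)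
  simp only [K]
  finiteness

theorem RHatJac_eq (X : C3) : RHatJac X = 32 * ((X 0 ^ 2 + X 1 ^ 2) * (X 1 *
    ((X 1 ^ 2 + X 2 ^ 2) * ((X 2 + X 0) * (X 2 + X 0) * (X 0 * X 2 - X 1 ^ 2))))) := by
  simp [RHatJac, coordSqJac, matSqJac, matSq]
  ring

theorem riesz_RHatJac (X : C3) : riesz (3 / 4) (RHatJac X) = riesz (3 / 4) 32 *
    (riesz (3 / 4) (X 0 ^ 2 + X 1 ^ 2) * (riesz (3 / 4) (X 1) *
      (riesz (3 / 4) (X 1 ^ 2 + X 2 ^ 2) *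
        (riesz (3 / 2) (X 2 + X 0) * riesz (3 / 4) (X 0 * X 2 - X 1 ^ 2))))) := by
  rw [RHatJac_eq]
  simp only [riesz_mul]
  rw [riesz_add (by norm_num) (by norm_num)]
  norm_num

theorem riesz_RHatJac_le_cuspBound {X : C3} (hU : 1 / 2 ≤ ‖X 0‖) (hV : ‖X 1‖ ≤ ‖X 0‖ / 2) :
    riesz (3 / 4) (RHatJac X) ≤ 4096 ^ 4 * cuspBound (X 0) (X 1) (X 2) := by
  rw [riesz_RHatJac]
  generalize X 0 = U at *
  generalize X 1 = V at *
  generalize X 2 = W at *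
  have h32 : riesz (3 / 4) 32 ≤ 4096 :=
    riesz_le_of_le_norm (by norm_num) (by norm_num) (by norm_num)
  have hq : riesz (3 / 4) (U ^ 2 + V ^ 2) ≤ 4096 := by
    refine riesz_le_of_le_norm (by norm_num) (by norm_num) ?_
    have := norm_le_norm_add_add (U ^ 2) (V ^ 2)
    rw [norm_pow, norm_pow] at this
    nlinarith [norm_nonneg V]
  have hb : riesz (3 / 4) (V ^ 2 + W ^ 2) * riesz (3 / 4) (U * W - V ^ 2) ≤
      riesz (3 / 4) V * (riesz (3 / 2) (W - Complex.I * V) + riesz (3 / 2) (W + Complex.I * V) +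
      2 * riesz (3 / 2) (U * W - V ^ 2)) := by
    have h1 : ∀ z, riesz (3 / 4) z * riesz (3 / 4) (U * W - V ^ 2) ≤
        riesz (3 / 2) z + riesz (3 / 2) (U * W - V ^ 2) := fun z => by
      refine (riesz_mul_le (by norm_num) (by norm_num) _ _).trans_eq ?_
      norm_num
    rw [add_comm (V ^ 2)]
    calc _ ≤ riesz (3 / 4) V * (riesz (3 / 4) (W - Complex.I * V) +
          riesz (3 / 4) (W + Complex.I * V)) * riesz (3 / 4) (U * W - V ^ 2) := by
          gcongr; exact riesz_sq_add_sq_le (by norm_num) _ _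
      _ = riesz (3 / 4) V * (riesz (3 / 4) (W - Complex.I * V) * riesz (3 / 4) (U * W - V ^ 2) +
          riesz (3 / 4) (W + Complex.I * V) * riesz (3 / 4) (U * W - V ^ 2)) := by ring
      _ ≤ riesz (3 / 4) V * ((riesz (3 / 2) (W - Complex.I * V) +
          riesz (3 / 2) (U * W - V ^ 2)) + (riesz (3 / 2) (W + Complex.I * V) +
          riesz (3 / 2) (U * W - V ^ 2))) := by gcongr <;> exact h1 _
      _ = _ := by ring
  -- The line `U + W = 0` stays away from the other branches.
  have hP : riesz (3 / 2) (W + U) * (riesz (3 / 4) (V ^ 2 + W ^ 2) * riesz (3 / 4) (U * W - V ^ 2))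
      ≤ 4096 * 4096 * (riesz (3 / 2) (W + U) +
        riesz (3 / 4) (V ^ 2 + W ^ 2) * riesz (3 / 4) (U * W - V ^ 2)) := by
    by_cases h : ‖U‖ / 4 ≤ ‖W + U‖
    · have h1 : riesz (3 / 2) (W + U) ≤ 4096 :=
        riesz_le_of_le_norm (by norm_num) (by norm_num) (by linarith)
      calc _ ≤ 4096 * 1 * (riesz (3 / 4) (V ^ 2 + W ^ 2) * riesz (3 / 4) (U * W - V ^ 2)) := by
            rw [mul_one]; gcongr
        _ ≤ _ := by gcongr; exacts [by norm_num, le_add_self]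
    · have hW : 3 / 4 * ‖U‖ ≤ ‖W‖ := by
        have := norm_le_norm_add_add U W
        rw [add_comm U W] at this
        linarith
      have hVV : ‖V‖ * ‖V‖ ≤ ‖U‖ * ‖U‖ / 4 := by nlinarith [norm_nonneg V]
      have hUU : 1 / 4 ≤ ‖U‖ * ‖U‖ := by nlinarith
      have h1 : riesz (3 / 4) (V ^ 2 + W ^ 2) ≤ 4096 := by
        refine riesz_le_of_le_norm (by norm_num) (by norm_num) ?_
        have := norm_le_norm_add_add (W ^ 2) (V ^ 2)
        rw [norm_pow, norm_pow, add_comm (W ^ 2)] at this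
        nlinarith
      have h2 : riesz (3 / 4) (U * W - V ^ 2) ≤ 4096 := by
        refine riesz_le_of_le_norm (by norm_num) (by norm_num) ?_
        have := norm_le_norm_add_add (U * W) (-V ^ 2)
        rw [norm_mul, ← sub_eq_add_neg, norm_neg, norm_pow] at this
        nlinarith
      calc _ ≤ riesz (3 / 2) (W + U) * (4096 * 4096) := by gcongr
        _ = 4096 * 4096 * riesz (3 / 2) (W + U) := by ring
        _ ≤ _ := by gcongr; exact le_self_add
  have hVV : riesz (3 / 4) V * riesz (3 / 4) V = riesz (3 / 2) V := by
    rw [riesz_add (by norm_num) (by norm_num)]; norm_num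
  calc _ = riesz (3 / 4) 32 * (riesz (3 / 4) (U ^ 2 + V ^ 2) * (riesz (3 / 4) V *
        (riesz (3 / 2) (W + U) *
          (riesz (3 / 4) (V ^ 2 + W ^ 2) * riesz (3 / 4) (U * W - V ^ 2))))) := by ring
    _ ≤ 4096 * (4096 * (riesz (3 / 4) V * (4096 * 4096 * (riesz (3 / 2) (W + U) +
        riesz (3 / 4) V * (riesz (3 / 2) (W - Complex.I * V) +
          riesz (3 / 2) (W + Complex.I * V) + 2 * riesz (3 / 2) (U * W - V ^ 2)))))) :=
        mul_le_mul' h32 (mul_le_mul' hq (mul_le_mul' le_rfl (hP.trans (by gcongr))))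
    _ = _ := by rw [cuspBound, ← hVV]; ring

theorem riesz_RHatJac_le_indetBound {X : C3} (hV : 1 / 4 ≤ ‖X 1‖)
    (hV2 : ‖X 1‖ ≤ 2) (hW2 : ‖X 2‖ ≤ 2) :
    riesz (3 / 4) (RHatJac X) ≤ 4096 ^ 4 * indetBound (X 1) (X 2) (X 0) := by
  rw [riesz_RHatJac]
  generalize X 0 = U at *
  generalize X 1 = V at *
  generalize X 2 = W at *
  have h32 : riesz (3 / 4) 32 ≤ 4096 :=
    riesz_le_of_le_norm (by norm_num) (by norm_num) (by norm_num)
  have hVn : riesz (3 / 4) V ≤ 4096 :=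
    riesz_le_of_le_norm (by norm_num) (by norm_num) (by linarith)
  have hIV : ‖Complex.I * V‖ = ‖V‖ := by simp
  -- Every pairwise distance of the roots in `U` is at least a multiple of `|W² + V²|`. The loss
  -- `9/8` leaves the exponents `3 - 9/8` in `U` and `3/4 + 9/8` in `W² + V²`, both below `2`.
  have key : ∀ i : ℂ, i ^ 2 = -1 → riesz (3 / 2) (W + U) *
      (riesz (3 / 4) (U * W - V ^ 2) * riesz (3 / 4) (U - i * V)) ≤
      4096 * riesz (9 / 8) (W ^ 2 + V ^ 2) * (riesz (15 / 8) (U + W) +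
        riesz (15 / 8) (W * U - V ^ 2) + riesz (15 / 8) (U - i * V)) := by
    intro i hi
    have hin : ‖i‖ = 1 := by
      have : ‖i‖ ^ 2 = 1 := by rw [← norm_pow, hi]; simp
      nlinarith [norm_nonneg i]
    have hiV : ‖i * V‖ = ‖V‖ := by rw [norm_mul, hin, one_mul]
    have hd : 2 * ‖(1 / 64 : ℂ) * (W ^ 2 + V ^ 2)‖ = ‖W ^ 2 + V ^ 2‖ / 32 := by
      rw [norm_mul]; simp; ring
    have hδ : ‖W ^ 2 + V ^ 2‖ ≤ 4 * ‖W + i * V‖ := by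
      rw [show W ^ 2 + V ^ 2 = (W - i * V) * (W + i * V) by linear_combination V ^ 2 * hi,
        norm_mul]
      gcongr
      exact (norm_sub_le _ _).trans (by rw [hiV]; linarith)
    have hxy : ‖W ^ 2 + V ^ 2‖ ≤ 2 * ‖W + U‖ + ‖U * W - V ^ 2‖ := by
      rw [show W ^ 2 + V ^ 2 = W * (W + U) - (U * W - V ^ 2) by ring]
      refine (norm_sub_le _ _).trans ?_
      rw [norm_mul]; gcongr
    have hxz : ‖W + i * V‖ ≤ ‖W + U‖ + ‖U - i * V‖ := by
      rw [show W + i * V = (W + U) - (U - i * V) by ring]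
      exact norm_sub_le _ _
    have hyz : ‖V‖ * ‖W + i * V‖ ≤ ‖U * W - V ^ 2‖ + 2 * ‖U - i * V‖ := by
      rw [← hiV, ← norm_mul,
        show i * V * (W + i * V) = (U * W - V ^ 2) - W * (U - i * V) by
          linear_combination V ^ 2 * hi]
      refine (norm_sub_le _ _).trans ?_
      rw [norm_mul]; gcongr
    have hyz' : ‖W + i * V‖ ≤ 4 * (‖U * W - V ^ 2‖ + 2 * ‖U - i * V‖) := by
      nlinarith [norm_nonneg (W + i * V)]
    have h1 := norm_nonneg (W + U)
    have h2 := norm_nonneg (U - i * V)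
    have h3 := norm_nonneg (U * W - V ^ 2)
    refine (riesz_mul_mul_le_of_separated (d := (1 / 64 : ℂ) * (W ^ 2 + V ^ 2)) (k := 9 / 8)
      (by norm_num) (by norm_num) (by norm_num) (by norm_num) (by norm_num) (by norm_num)
      (by norm_num) (by linarith) (by linarith) (by linarith)).trans ?_
    rw [riesz_mul, show (3 / 2 + 3 / 4 + 3 / 4 - 9 / 8 : ℝ) = 15 / 8 by norm_num, add_comm W U,
      mul_comm U W]
    gcongr
    exact riesz_le_of_le_norm (by norm_num) (by norm_num) (by norm_num)
  have hI := key Complex.I Complex.I_sq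
  have hI' := key (-Complex.I) (by rw [neg_sq, Complex.I_sq])
  rw [neg_mul, sub_neg_eq_add] at hI'
  have hδδ : riesz (3 / 4) (W ^ 2 + V ^ 2) * riesz (9 / 8) (W ^ 2 + V ^ 2) =
      riesz (15 / 8) (W ^ 2 + V ^ 2) := by
    rw [riesz_add (by norm_num) (by norm_num)]; norm_num
  have hmem : V ∈ {V : ℂ | 1 / 4 ≤ ‖V‖} := hV
  rw [indetBound, Set.indicator_of_mem hmem, Pi.one_apply, one_mul, ← hδδ, add_comm (V ^ 2) (W ^ 2)]
  calc _ ≤ 4096 * (4096 * (riesz (3 / 4) (U - Complex.I * V) +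
          riesz (3 / 4) (U + Complex.I * V)) * (4096 * (riesz (3 / 4) (W ^ 2 + V ^ 2) *
        (riesz (3 / 2) (W + U) * riesz (3 / 4) (U * W - V ^ 2))))) := by
        gcongr
        exact (riesz_sq_add_sq_le (by norm_num) _ _).trans (by gcongr)
    _ = 4096 ^ 3 * (riesz (3 / 4) (W ^ 2 + V ^ 2) * (riesz (3 / 2) (W + U) *
          (riesz (3 / 4) (U * W - V ^ 2) * riesz (3 / 4) (U - Complex.I * V)) +
        riesz (3 / 2) (W + U) *
          (riesz (3 / 4) (U * W - V ^ 2) * riesz (3 / 4) (U + Complex.I * V)))) := by ring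
    _ ≤ 4096 ^ 3 * (riesz (3 / 4) (W ^ 2 + V ^ 2) * (4096 * riesz (9 / 8) (W ^ 2 + V ^ 2) *
          (riesz (15 / 8) (U + W) + riesz (15 / 8) (W * U - V ^ 2) +
            riesz (15 / 8) (U - Complex.I * V)) +
        4096 * riesz (9 / 8) (W ^ 2 + V ^ 2) * (riesz (15 / 8) (U + W) +
          riesz (15 / 8) (W * U - V ^ 2) + riesz (15 / 8) (U + Complex.I * V)))) := by gcongr
    _ = _ := by ring

theorem RHatJac_swap (X : C3) : RHatJac !₂[X 2, X 1, X 0] = RHatJac X := by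
  simp [RHatJac_eq]; ring

/-- The shell is covered by the regions where `|V| ≥ 1/4`, where `|U|` is large compared to `|V|`,
and where `|W|` is. -/
theorem lintegral_riesz_RHatJac_lt_top :
    ∫⁻ X in shell, riesz (3 / 4) (RHatJac X) ∂Measure.addHaar < ∞ := by
  have hA := lintegral_shell_lt_top 1 measurable_cuspBound lintegral_cuspBound_lt_top
  have hA' := lintegral_shell_lt_top (Equiv.swap 0 2) measurable_cuspBound
    lintegral_cuspBound_lt_top
  have hB := lintegral_shell_lt_top (finRotate 3) measurable_indetBound
    lintegral_indetBound_lt_top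
  rw [show (Equiv.swap 0 2 : Equiv.Perm (Fin 3)) 1 = 1 by decide, Equiv.swap_apply_left,
    Equiv.swap_apply_right] at hA'
  rw [show finRotate 3 0 = 1 by decide, show finRotate 3 1 = 2 by decide,
    show finRotate 3 2 = 0 by decide] at hB
  simp only [Equiv.Perm.one_apply] at hA
  obtain ⟨K, hK, hKA, hKB⟩ : ∃ K : ℝ≥0∞, K ≠ ∞ ∧
      (∀ X : C3, 1 / 2 ≤ ‖X 0‖ → ‖X 1‖ ≤ ‖X 0‖ / 2 →
        riesz (3 / 4) (RHatJac X) ≤ K * cuspBound (X 0) (X 1) (X 2)) ∧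
      ∀ X : C3, 1 / 4 ≤ ‖X 1‖ → ‖X 1‖ ≤ 2 → ‖X 2‖ ≤ 2 →
        riesz (3 / 4) (RHatJac X) ≤ K * indetBound (X 1) (X 2) (X 0) :=
    ⟨4096 ^ 4, by finiteness, fun X => riesz_RHatJac_le_cuspBound,
      fun X => riesz_RHatJac_le_indetBound⟩
  have hproj : ∀ i : Fin 3, Measurable fun X : C3 => X i := fun i =>
    (EuclideanSpace.proj i : C3 →L[ℂ] ℂ).continuous.measurable
  have hmA : Measurable fun X : C3 => cuspBound (X 0) (X 1) (X 2) :=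
    measurable_cuspBound.comp (f := fun X : C3 => (X 0, X 1, X 2))
      ((hproj 0).prodMk ((hproj 1).prodMk (hproj 2)))
  have hmA' : Measurable fun X : C3 => cuspBound (X 2) (X 1) (X 0) :=
    measurable_cuspBound.comp (f := fun X : C3 => (X 2, X 1, X 0))
      ((hproj 2).prodMk ((hproj 1).prodMk (hproj 0)))
  have hmB : Measurable fun X : C3 => indetBound (X 1) (X 2) (X 0) :=
    measurable_indetBound.comp (f := fun X : C3 => (X 1, X 2, X 0))
      ((hproj 1).prodMk ((hproj 2).prodMk (hproj 0)))
  calc ∫⁻ X in shell, riesz (3 / 4) (RHatJac X) ∂Measure.addHaar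
      ≤ ∫⁻ X in shell, K * (cuspBound (X 0) (X 1) (X 2) + cuspBound (X 2) (X 1) (X 0) +
          indetBound (X 1) (X 2) (X 0)) ∂Measure.addHaar := by
        refine setLIntegral_mono (((hmA.add hmA').add hmB).const_mul _) fun X hX => ?_
        have h2 : ∀ i, ‖X i‖ ≤ 2 := fun i => ((PiLp.norm_apply_le X i).trans_lt hX.2).le
        have hsum : 1 < ‖X 0‖ ^ 2 + ‖X 1‖ ^ 2 + ‖X 2‖ ^ 2 := by
          have h := EuclideanSpace.norm_sq_eq X
          rw [Fin.sum_univ_three] at h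
          nlinarith [hX.1]
        by_cases hV : 1 / 4 ≤ ‖X 1‖
        · refine (hKB X hV (h2 1) (h2 2)).trans ?_
          gcongr
          exact le_add_self
        rw [not_le] at hV
        rcases le_total ‖X 2‖ ‖X 0‖ with h | h
        · have hU : 1 / 2 ≤ ‖X 0‖ := by
            nlinarith [norm_nonneg (X 0), norm_nonneg (X 1), norm_nonneg (X 2)]
          refine (hKA X hU (by linarith)).trans ?_
          gcongr
          exact le_self_add.trans le_self_add
        · have hW : 1 / 2 ≤ ‖X 2‖ := by
            nlinarith [norm_nonneg (X 0), norm_nonneg (X 1), norm_nonneg (X 2)]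
          rw [← RHatJac_swap]
          refine (hKA !₂[X 2, X 1, X 0] hW
            (show ‖X 1‖ ≤ ‖X 2‖ / 2 by linarith)).trans ?_
          gcongr
          exact le_add_self.trans le_self_add
    _ < ∞ := by
        rw [lintegral_const_mul' _ _ hK, lintegral_add_right _ hmB,
          lintegral_add_right _ hmA']
        finiteness

/-! ### Moments of pullbacks -/

/-- A function on `ℂ³` that is constant along real rays from the origin. -/
def RayInvariant (g : C3 → ℝ≥0∞) : Prop := ∀ (r : ℝ) (X : C3), 0 < r → g (r • X) = g X

theorem RayInvariant.comp_RHat {g : C3 → ℝ≥0∞} (hg : RayInvariant g) :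
    RayInvariant fun X => g (RHat X) := fun r X hr => by
  have h : RHat (r • X) = (r ^ 4 : ℝ) • RHat X := by
    rw [← Complex.coe_smul, RHat_smul, ← Complex.ofReal_pow, Complex.coe_smul]
  simp only [h]
  exact hg _ _ (by positivity)

theorem RayInvariant.comp_iterate {g : C3 → ℝ≥0∞} (hg : RayInvariant g) (n : ℕ) :
    RayInvariant fun X => g (RHat^[n] X) := by
  induction n with
  | zero => exact hg
  | succ n ih => exact ih.comp_RHat

theorem RayInvariant.rpow {g : C3 → ℝ≥0∞} (hg : RayInvariant g) (e : ℝ) :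
    RayInvariant fun X => g X ^ e := fun r X hr => by simp only [hg r X hr]

/-- The measure of the interval `(1, 2)` of radii for the density `r⁵`: the factor between the
integrals over the shell and over the unit sphere. -/
def shellMass : ℝ≥0∞ :=
  Measure.volumeIoiPow (Module.finrank ℝ C3 - 1) (Subtype.val ⁻¹' Set.Ioo (1 : ℝ) 2)

theorem lintegral_shell {g : C3 → ℝ≥0∞} (hm : Measurable g) (hg : RayInvariant g) :
    ∫⁻ X in shell, g X ∂Measure.addHaar = (∫⁻ v, g v ∂sphereMeasure) * shellMass :=
  lintegral_of_constant_on_rays _ hm hg measurableSet_Ioo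

theorem volumeIoiPow_preimage_Iio_lt_top (n : ℕ) (M : ℝ) :
    Measure.volumeIoiPow n (Subtype.val ⁻¹' Set.Iio M) < ∞ := by
  have h : (Subtype.val ⁻¹' Set.Iio M : Set (Set.Ioi (0 : ℝ))) ⊆
      Set.Iio ⟨max M 1, Set.mem_Ioi.2 (lt_max_of_lt_right one_pos)⟩ := fun x hx =>
    lt_of_lt_of_le (show (x : ℝ) < M from hx) (le_max_left M 1)
  refine (measure_mono h).trans_lt ?_
  rw [Measure.volumeIoiPow_apply_Iio]
  exact ENNReal.ofReal_lt_top

theorem shellMass_ne_top : shellMass ≠ ∞ :=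
  ((measure_mono (Set.preimage_mono fun _ h => h.2)).trans_lt
    (volumeIoiPow_preimage_Iio_lt_top _ 2)).ne

theorem measure_shell_lt_top : (Measure.addHaar : Measure C3) shell < ∞ :=
  (measure_mono fun _ hX => mem_ball_zero_iff.2 hX.2).trans_lt
    (measure_ball_lt_top (x := (0 : C3)) (r := 2))

theorem shellMass_ne_zero : shellMass ≠ 0 := by
  intro h
  have h1 := lintegral_shell (g := fun _ => 1) measurable_const fun _ _ _ => rfl
  rw [h, mul_zero, setLIntegral_one] at h1
  have hopen : IsOpen shell := isOpen_Ioo.preimage continuous_norm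
  refine hopen.measure_ne_zero _ ?_ h1
  refine ⟨EuclideanSpace.single 0 (3 / 2 : ℂ), ?_⟩
  change ‖EuclideanSpace.single 0 (3 / 2 : ℂ)‖ ∈ Set.Ioo (1 : ℝ) 2
  rw [PiLp.norm_single]
  norm_num

theorem exists_lintegral_ball_le (M : ℝ) : ∃ C : ℝ≥0∞, C ≠ ∞ ∧ ∀ g : C3 → ℝ≥0∞, Measurable g →
    RayInvariant g → ∫⁻ X in {X : C3 | ‖X‖ ∈ Set.Iio M}, g X ∂Measure.addHaar ≤
      C * ∫⁻ X in shell, g X ∂Measure.addHaar := by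
  refine ⟨Measure.volumeIoiPow (Module.finrank ℝ C3 - 1) (Subtype.val ⁻¹' Set.Iio M) *
    shellMass⁻¹, ENNReal.mul_ne_top (volumeIoiPow_preimage_Iio_lt_top _ M).ne
      (ENNReal.inv_ne_top.2 shellMass_ne_zero), fun g hm hg => ?_⟩
  rw [lintegral_shell hm hg, lintegral_of_constant_on_rays _ hm hg measurableSet_Iio]
  change (∫⁻ v, g v ∂sphereMeasure) * _ ≤ _
  rw [mul_comm _ shellMass, mul_assoc, ← mul_assoc shellMass⁻¹,
    ENNReal.inv_mul_cancel shellMass_ne_zero shellMass_ne_top, one_mul, mul_comm]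

/-- The pullback estimate: Hölder's inequality against `|det DR̂|^(-6/11)`, whose `11/8`-th power is
integrable, and the change of variables `Y = R̂ X`. It matters that `3/11 > 1/4`. -/
theorem exists_lintegral_comp_RHat_rpow_le : ∃ C : ℝ≥0∞, C ≠ ∞ ∧ ∀ g : C3 → ℝ≥0∞,
    Measurable g → RayInvariant g →
      ∫⁻ X in shell, g (RHat X) ^ (3 / 11 : ℝ) ∂Measure.addHaar ≤
        C * (∫⁻ X in shell, g X ∂Measure.addHaar) ^ (3 / 11 : ℝ) := by
  obtain ⟨M, hM⟩ : ∃ M, ∀ X ∈ shell, ‖RHat X‖ < M := by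
    obtain ⟨M, hM⟩ := (isCompact_closedBall (0 : C3) 2).exists_bound_of_continuousOn
      continuous_RHat.continuousOn
    exact ⟨M + 1, fun X hX => (hM X (by simpa using hX.2.le)).trans_lt (lt_add_one M)⟩
  obtain ⟨C, hC, hball⟩ := exists_lintegral_ball_le M
  have hJ := lintegral_riesz_RHatJac_lt_top
  have hJm : Measurable RHatJac := continuous_RHatJac.measurable
  have hRm : Measurable RHat := continuous_RHat.measurable
  have hJ0 : ∀ᵐ X ∂(Measure.addHaar : Measure C3).restrict shell, RHatJac X ≠ 0 := by
    filter_upwards [ae_lt_top (measurable_riesz_comp _ hJm) hJ.ne] with X hX h0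
    rw [h0, riesz_zero (by norm_num)] at hX
    exact lt_irrefl _ hX
  refine ⟨(32 * C) ^ (3 / 11 : ℝ) *
    (∫⁻ X in shell, riesz (3 / 4) (RHatJac X) ∂Measure.addHaar) ^ (8 / 11 : ℝ),
    ENNReal.mul_ne_top (ENNReal.rpow_ne_top_of_nonneg (by norm_num) (by finiteness))
      (ENNReal.rpow_ne_top_of_nonneg (by norm_num) hJ.ne), fun g hm hg => ?_⟩
  have hpq : (11 / 3 : ℝ).HolderConjugate (11 / 8) := by
    rw [Real.holderConjugate_iff]; norm_num
  calc ∫⁻ X in shell, g (RHat X) ^ (3 / 11 : ℝ) ∂Measure.addHaar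
      = ∫⁻ X in shell, (‖RHatJac X‖ₑ ^ 2 * g (RHat X)) ^ (3 / 11 : ℝ) *
          riesz (6 / 11) (RHatJac X) ∂Measure.addHaar := by
        refine lintegral_congr_ae ?_
        filter_upwards [hJ0] with X hX
        have h0 : ‖RHatJac X‖ₑ ≠ 0 := enorm_ne_zero.2 hX
        rw [ENNReal.mul_rpow_of_nonneg _ _ (by norm_num), riesz, ← ENNReal.rpow_two,
          ← ENNReal.rpow_mul, mul_right_comm, ← ENNReal.rpow_add _ _ h0 enorm_ne_top]
        norm_num
    _ ≤ (∫⁻ X in shell, ‖RHatJac X‖ₑ ^ 2 * g (RHat X) ∂Measure.addHaar) ^ (3 / 11 : ℝ) *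
          (∫⁻ X in shell, riesz (3 / 4) (RHatJac X) ∂Measure.addHaar) ^ (8 / 11 : ℝ) := by
        refine (ENNReal.lintegral_mul_le_Lp_mul_Lq _ hpq
          (((hJm.enorm.pow_const 2).mul (hm.comp hRm)).pow_const _).aemeasurable
          (measurable_riesz_comp _ hJm).aemeasurable).trans_eq ?_
        simp only [riesz, ← ENNReal.rpow_mul]
        norm_num
    _ ≤ (32 * (C * ∫⁻ X in shell, g X ∂Measure.addHaar)) ^ (3 / 11 : ℝ) *
          (∫⁻ X in shell, riesz (3 / 4) (RHatJac X) ∂Measure.addHaar) ^ (8 / 11 : ℝ) := by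
        gcongr
        exact (lintegral_comp_RHat_le hm measurableSet_shell (measurable_norm measurableSet_Iio)
          fun X hX => hM X hX).trans (by gcongr; exact hball g hm hg)
    _ = _ := by
        rw [← mul_assoc, ENNReal.mul_rpow_of_nonneg _ _ (by norm_num : (0 : ℝ) ≤ 3 / 11)]
        ring

/-- The exponents shrink geometrically, but the moments stay bounded. -/
theorem exists_lintegral_comp_iterate_rpow_le {g : C3 → ℝ≥0∞} (hm : Measurable g)
    (hg : RayInvariant g) (hfin : ∫⁻ X in shell, g X ∂Measure.addHaar ≠ ∞) :
    ∃ D : ℝ≥0∞, D ≠ ∞ ∧ ∀ n : ℕ,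
      ∫⁻ X in shell, g (RHat^[n] X) ^ ((3 / 11 : ℝ) ^ n) ∂Measure.addHaar ≤ D := by
  obtain ⟨C, hC, h⟩ := exists_lintegral_comp_RHat_rpow_le
  -- The power `C ^ (11 / 8)` is the fixed point of `t ↦ C t ^ (3 / 11)`.
  set D : ℝ≥0∞ := (∫⁻ X in shell, g X ∂Measure.addHaar) + C ^ (11 / 8 : ℝ) with hDdef
  have hD : D ≠ ∞ :=
    ENNReal.add_ne_top.2 ⟨hfin, ENNReal.rpow_ne_top_of_nonneg (by norm_num) hC⟩
  have hCD : C * D ^ (3 / 11 : ℝ) ≤ D := by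
    have h1 : C ≤ D ^ (8 / 11 : ℝ) := by
      calc C = (C ^ (11 / 8 : ℝ)) ^ (8 / 11 : ℝ) := by rw [← ENNReal.rpow_mul]; norm_num
        _ ≤ D ^ (8 / 11 : ℝ) := by gcongr; exact le_add_self
    calc C * D ^ (3 / 11 : ℝ) ≤ D ^ (8 / 11 : ℝ) * D ^ (3 / 11 : ℝ) := by gcongr
      _ = D := by
        rw [← ENNReal.rpow_add_of_nonneg _ _ (by norm_num) (by norm_num)]; norm_num
  refine ⟨D, hD, fun n => ?_⟩
  induction n with
  | zero => simpa using le_self_add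
  | succ n ih =>
    have hmn : Measurable fun X => g (RHat^[n] X) ^ ((3 / 11 : ℝ) ^ n) :=
      (hm.comp (continuous_RHat.iterate n).measurable).pow_const _
    calc _ = ∫⁻ X in shell, (g (RHat^[n] (RHat X)) ^ ((3 / 11 : ℝ) ^ n)) ^ (3 / 11 : ℝ)
          ∂Measure.addHaar := by
          simp only [← ENNReal.rpow_mul, ← pow_succ, Function.iterate_succ_apply]
      _ ≤ C * (∫⁻ X in shell, g (RHat^[n] X) ^ ((3 / 11 : ℝ) ^ n) ∂Measure.addHaar) ^
          (3 / 11 : ℝ) := h _ hmn ((hg.comp_iterate n).rpow _)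
      _ ≤ C * D ^ (3 / 11 : ℝ) := by gcongr
      _ ≤ D := hCD

/-! ### The reciprocal of the norm of a section -/

/-- The reciprocal of `‖σ_Y [X]‖`, with the value `∞` also at `X = 0`. -/
def recipSec (Y : C3 →L[ℂ] ℂ) (X : C3) : ℝ≥0∞ := (‖Y X‖ₑ / ‖X‖ₑ)⁻¹

theorem measurable_recipSec (Y : C3 →L[ℂ] ℂ) : Measurable (recipSec Y) := by
  unfold recipSec
  have := Y.continuous.measurable
  fun_prop

theorem rayInvariant_recipSec (Y : C3 →L[ℂ] ℂ) : RayInvariant (recipSec Y) := fun r X hr => by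
  have h1 : Y (r • X) = r • Y X := by
    rw [← Complex.coe_smul, map_smul, Complex.coe_smul]
  have h2 : ‖r‖ₑ ≠ 0 := enorm_ne_zero.2 hr.ne'
  rw [recipSec, recipSec, h1, enorm_smul, enorm_smul, ENNReal.mul_div_mul_left _ _ h2 enorm_ne_top]

theorem lintegral_recipSec_linForm_lt_top {p : ℂ} (q r : ℂ) (hp : p ≠ 0) :
    ∫⁻ X in shell, recipSec (linForm p q r) X ∂Measure.addHaar < ∞ := by
  obtain ⟨C, hC, -, -, -, h⟩ := exists_lintegral_riesz_le (e := 1) one_pos one_lt_two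
  have hfin : ∫⁻ V in disc, ∫⁻ W in disc, ∫⁻ U in disc,
      riesz 1 (p * U - -(q * V + r * W)) < ∞ := by
    have hp1 : riesz 1 p ≠ ∞ := by
      rw [riesz, ENNReal.rpow_neg, ENNReal.rpow_one]
      exact ENNReal.inv_ne_top.2 (enorm_ne_zero.2 hp)
    refine (lintegral_mono fun V => lintegral_mono fun W => h p _).trans_lt
      (lintegral_disc_const_lt_top (lintegral_disc_const_lt_top ?_).ne)
    finiteness
  have hs := lintegral_shell_lt_top (finRotate 3)
    (F := fun V W U => riesz 1 (p * U - -(q * V + r * W))) (by fun_prop) hfin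
  rw [show finRotate 3 0 = 1 by decide, show finRotate 3 1 = 2 by decide,
    show finRotate 3 2 = 0 by decide] at hs
  refine lt_of_le_of_lt ?_ (ENNReal.mul_lt_top (a := 2) (by finiteness) hs)
  rw [← lintegral_const_mul' _ _ (by finiteness)]
  refine setLIntegral_mono' measurableSet_shell fun X hX => ?_
  have hX0 : ‖X‖ₑ ≠ 0 := enorm_ne_zero.2 (norm_pos_iff.1 (zero_lt_one.trans hX.1))
  have hX2 : ‖X‖ₑ ≤ 2 := by
    have h2 : ENNReal.ofReal ‖X‖ ≤ ENNReal.ofReal 2 := ENNReal.ofReal_le_ofReal hX.2.le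
    rwa [ofReal_norm, ENNReal.ofReal_ofNat] at h2
  have hY : linForm p q r X = p * X 0 - -(q * X 1 + r * X 2) := by
    rw [linForm_apply]; ring
  rw [recipSec, ENNReal.inv_div (Or.inl enorm_ne_top) (Or.inl hX0), hY, div_eq_mul_inv, riesz,
    ENNReal.rpow_neg_one]
  gcongr

/-- The elementary bound `|log a| ≤ a⁻ᵝ / β + log (1 + c)` for `0 ≤ a ≤ c`. -/
theorem ofReal_abs_log_le (Y : C3 →L[ℂ] ℂ) (Z : C3) {β : ℝ} (hβ : 0 < β) :
    ENNReal.ofReal |Real.log (‖Y Z‖ / ‖Z‖)| ≤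
      ENNReal.ofReal (1 / β) * recipSec Y Z ^ β + ENNReal.ofReal (Real.log (1 + ‖Y‖)) := by
  rcases eq_or_ne (Y Z) 0 with h0 | h0
  · simp [h0]
  have hZ : Z ≠ 0 := fun h => h0 (by rw [h, map_zero])
  have hZ' : 0 < ‖Z‖ := norm_pos_iff.2 hZ
  have ha : 0 < ‖Y Z‖ / ‖Z‖ := div_pos (norm_pos_iff.2 h0) hZ'
  have hle : ‖Y Z‖ / ‖Z‖ ≤ 1 + ‖Y‖ := by
    rw [div_le_iff₀ hZ']
    nlinarith [Y.le_opNorm Z]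
  have hrec : recipSec Y Z = ENNReal.ofReal (‖Y Z‖ / ‖Z‖)⁻¹ := by
    rw [recipSec, ENNReal.ofReal_inv_of_pos ha, ENNReal.ofReal_div_of_pos hZ', ofReal_norm,
      ofReal_norm]
  have hlog : 0 ≤ Real.log (1 + ‖Y‖) := Real.log_nonneg (by linarith [norm_nonneg Y])
  generalize ‖Y Z‖ / ‖Z‖ = a at *
  rw [hrec, ENNReal.ofReal_rpow_of_pos (inv_pos.2 ha), ← ENNReal.ofReal_mul (by positivity),
    ← ENNReal.ofReal_add (by positivity) hlog]
  refine ENNReal.ofReal_le_ofReal ?_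
  have h1 : Real.log a⁻¹ ≤ a⁻¹ ^ β / β := Real.log_le_rpow_div (by positivity) hβ
  have h2 : 0 ≤ a⁻¹ ^ β / β := by positivity
  have h3 : Real.log a ≤ Real.log (1 + ‖Y‖) := Real.log_le_log ha hle
  rw [Real.log_inv] at h1
  rw [one_div_mul_eq_div, abs_le]
  constructor <;> linarith

/-! ### Functions on the projective plane -/

/-- The Fubini–Study integral of a function is dominated by the integral over the shell of any
majorant in homogeneous coordinates. -/
theorem exists_lintegral_fubiniStudy_le : ∃ c : ℝ≥0∞, c ≠ ∞ ∧ ∀ (f : CP2 → ℝ≥0∞)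
    (g : C3 → ℝ≥0∞), Measurable f → Measurable g → RayInvariant g →
    (∀ X hX, f (Projectivization.mk ℂ X hX) ≤ g X) →
      ∫⁻ x, f x ∂fubiniStudy ≤ c * ∫⁻ X in shell, g X ∂Measure.addHaar := by
  have hs : sphereMeasure Set.univ ≠ 0 := by
    rw [Ne, Measure.measure_univ_eq_zero]
    exact Measure.toSphere_ne_zero _
  refine ⟨(sphereMeasure Set.univ)⁻¹ * shellMass⁻¹, ENNReal.mul_ne_top (ENNReal.inv_ne_top.2 hs)
    (ENNReal.inv_ne_top.2 shellMass_ne_zero), fun f g hf hg hray hfg => ?_⟩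
  rw [fubiniStudy, lintegral_map hf continuous_hopf.measurable, lintegral_smul_measure,
    lintegral_shell hg hray, mul_assoc, mul_comm _ shellMass, ← mul_assoc shellMass⁻¹,
    ENNReal.inv_mul_cancel shellMass_ne_zero shellMass_ne_top, one_mul, smul_eq_mul]
  gcongr with v
  exact hfg _ _

theorem RHat_iterate_smul (n : ℕ) (c : ℂ) (X : C3) :
    RHat^[n] (c • X) = c ^ 4 ^ n • RHat^[n] X := by
  induction n with
  | zero => simp
  | succ n ih =>
    rw [Function.iterate_succ_apply', Function.iterate_succ_apply', ih, RHat_smul, ← pow_mul,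
      pow_succ]

/-- The function `[X] ↦ Φ X / ‖X‖ ^ d` on `ℂℙ²` induced by an absolutely homogeneous function `Φ` of
degree `d` on `ℂ³`. -/
def descend (d : ℕ) (Φ : C3 → ℝ) (x : CP2) : ℝ := Φ x.rep / ‖x.rep‖ ^ d

theorem descend_mk {d : ℕ} {Φ : C3 → ℝ} (hΦ : ∀ (c : ℂ) X, Φ (c • X) = ‖c‖ ^ d * Φ X) (X : C3)
    (hX : X ≠ 0) : descend d Φ (Projectivization.mk ℂ X hX) = Φ X / ‖X‖ ^ d := by
  obtain ⟨a, ha⟩ := Projectivization.exists_smul_eq_mk_rep ℂ X hX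
  rw [descend, ← ha, Units.smul_def, hΦ, norm_smul, mul_pow]
  exact mul_div_mul_left _ _ (pow_ne_zero _ (norm_ne_zero_iff.2 a.ne_zero))

theorem continuous_descend {d : ℕ} {Φ : C3 → ℝ} (hΦ : ∀ (c : ℂ) X, Φ (c • X) = ‖c‖ ^ d * Φ X)
    (hc : Continuous Φ) : Continuous (descend d Φ) := by
  refine continuous_coinduced_dom.2 ?_
  have : descend d Φ ∘ Projectivization.mk' ℂ =
      fun v : {v : C3 // v ≠ 0} => Φ v / ‖(v : C3)‖ ^ d := by
    ext v
    exact descend_mk hΦ v.1 v.2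
  rw [this]
  refine (hc.comp continuous_subtype_val).div (by fun_prop) fun v => ?_
  exact pow_ne_zero _ (norm_ne_zero_iff.2 v.2)

theorem norm_iterate_smul (n : ℕ) (c : ℂ) (X : C3) :
    ‖RHat^[n] (c • X)‖ = ‖c‖ ^ 4 ^ n * ‖RHat^[n] X‖ := by
  rw [RHat_iterate_smul, norm_smul, norm_pow]

theorem norm_apply_iterate_smul (Y : C3 →L[ℂ] ℂ) (n : ℕ) (c : ℂ) (X : C3) :
    ‖Y (RHat^[n] (c • X))‖ = ‖c‖ ^ 4 ^ n * ‖Y (RHat^[n] X)‖ := by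
  rw [RHat_iterate_smul, map_smul, norm_smul, norm_pow]

/-- Where `Rⁿ` is undefined, both sides vanish, since division by `0` and `Real.log 0` give `0`. -/
theorem potential_mk_eq (Y : C3 →L[ℂ] ℂ) (n : ℕ) (X : C3) (hX : X ≠ 0) :
    potential Y n (Projectivization.mk ℂ X hX) =
      1 / 4 ^ n * Real.log (‖Y (RHat^[n] X)‖ / ‖RHat^[n] X‖) := by
  by_cases h : RHat^[n] X = 0
  · rw [potential, dif_neg]
    · simp [h]
    · intro hd
      obtain ⟨h', -⟩ := (mem_iterR_mk n X hX _).1 (Part.get_mem hd)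
      exact h' h
  · exact potential_mk Y n X hX h

/-- The potential is a Borel function of two continuous functions on `ℂℙ²`. -/
theorem measurable_potential (Y : C3 →L[ℂ] ℂ) (n : ℕ) : Measurable (potential Y n) := by
  have h : potential Y n = fun x => 1 / 4 ^ n *
      Real.log (descend (4 ^ n) (fun X => ‖Y (RHat^[n] X)‖) x /
        descend (4 ^ n) (fun X => ‖RHat^[n] X‖) x) := by
    ext x
    induction x using Projectivization.ind with
    | h X hX =>
      rw [potential_mk_eq, descend_mk (norm_apply_iterate_smul Y n),
        descend_mk (norm_iterate_smul n), div_div_div_cancel_right₀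
          (pow_ne_zero _ (norm_ne_zero_iff.2 hX))]
  rw [h]
  have hR := continuous_RHat.iterate n
  have h1 := (continuous_descend (norm_apply_iterate_smul Y n)
    (Y.continuous.comp hR).norm).measurable
  have h2 := (continuous_descend (norm_iterate_smul n) hR.norm).measurable
  exact (Real.measurable_log.comp (h1.div h2)).const_mul _

theorem sec_mk_eq_zero_iff (Y : C3 →L[ℂ] ℂ) (X : C3) (hX : X ≠ 0) :
    sec Y (Projectivization.mk ℂ X hX) = 0 ↔ Y X = 0 := by
  constructor
  · intro h
    have hmem : X ∈ (Projectivization.mk ℂ X hX).submodule := by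
      rw [Projectivization.submodule_mk]; exact Submodule.mem_span_singleton_self X
    exact DFunLike.congr_fun h ⟨X, hmem⟩
  · intro h
    ext ⟨v, hv⟩
    rw [Projectivization.submodule_mk] at hv
    obtain ⟨c, rfl⟩ := Submodule.mem_span_singleton.1 hv
    change Y (c • X) = 0
    rw [map_smul, h, smul_zero]

theorem exists_mem_iterR_sec_ne_zero_iff (Y : C3 →L[ℂ] ℂ) (n : ℕ) (X : C3) (hX : X ≠ 0) :
    (∃ y ∈ iterR n (Projectivization.mk ℂ X hX), sec Y y ≠ 0) ↔ Y (RHat^[n] X) ≠ 0 := by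
  constructor
  · rintro ⟨y, hy, hs⟩ h0
    obtain ⟨h, rfl⟩ := (mem_iterR_mk n X hX y).1 hy
    exact hs ((sec_mk_eq_zero_iff Y _ h).2 h0)
  · intro h0
    have h : RHat^[n] X ≠ 0 := fun h => h0 (by rw [h, map_zero])
    refine ⟨_, (mem_iterR_mk n X hX _).2 ⟨h, rfl⟩, fun hs => h0 ?_⟩
    exact (sec_mk_eq_zero_iff Y _ h).1 hs

/-- Where `σ_Y ∘ Rⁿ` vanishes or `Rⁿ` is undefined, the pulled back `recipSec` is `∞`, so this set
is null because some moment is finite. -/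
theorem ae_exists_mem_iterR (Y : C3 →L[ℂ] ℂ)
    (hY : ∫⁻ X in shell, recipSec Y X ∂Measure.addHaar ≠ ∞) (n : ℕ) :
    ∀ᵐ x ∂fubiniStudy, ∃ y ∈ iterR n x, sec Y y ≠ 0 := by
  obtain ⟨c, hc, hcmp⟩ := exists_lintegral_fubiniStudy_le
  obtain ⟨D, hD, hiter⟩ := exists_lintegral_comp_iterate_rpow_le (measurable_recipSec Y)
    (rayInvariant_recipSec Y) hY
  let Φ : CP2 → ℝ := descend (4 ^ n) fun X => ‖Y (RHat^[n] X)‖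
  have hΦ : Measurable Φ := (continuous_descend (norm_apply_iterate_smul Y n)
    (Y.continuous.comp (continuous_RHat.iterate n)).norm).measurable
  have hmk : ∀ X hX, Φ (Projectivization.mk ℂ X hX) = 0 ↔ Y (RHat^[n] X) = 0 := fun X hX => by
    simp only [Φ]
    rw [descend_mk (norm_apply_iterate_smul Y n), div_eq_zero_iff,
      or_iff_left (pow_ne_zero _ (norm_ne_zero_iff.2 hX)), norm_eq_zero]
  have hset : MeasurableSet {x | Φ x = 0} := hΦ (measurableSet_singleton 0)
  have hint : ∫⁻ x, ({x | Φ x = 0}).indicator (fun _ => ∞) x ∂fubiniStudy < ∞ := by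
    refine (hcmp _ (fun X => recipSec Y (RHat^[n] X) ^ ((3 / 11 : ℝ) ^ n))
      (measurable_const.indicator hset)
      (((measurable_recipSec Y).comp (continuous_RHat.iterate n).measurable).pow_const _)
      (((rayInvariant_recipSec Y).comp_iterate n).rpow _) fun X hX => ?_).trans_lt
        ((mul_le_mul_right (hiter n) c).trans_lt (by finiteness))
    by_cases h : Y (RHat^[n] X) = 0
    · have h1 : recipSec Y (RHat^[n] X) = ∞ := by simp [recipSec, h]
      rw [h1, ENNReal.top_rpow_of_pos (by positivity)]
      exact le_top
    · rw [Set.indicator_of_notMem]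
      · exact zero_le
      · exact fun h' => h ((hmk X hX).1 h')
  filter_upwards [ae_lt_top (measurable_const.indicator hset) hint.ne] with x hx
  induction x using Projectivization.ind with
  | h X hX =>
    rw [exists_mem_iterR_sec_ne_zero_iff]
    intro h
    rw [Set.indicator_of_mem (show _ ∈ {x | Φ x = 0} from (hmk X hX).2 h)] at hx
    exact lt_irrefl _ hx

/-- The rate is `(11/12)ⁿ = 4⁻ⁿ (11/3)ⁿ`: the factor `(11/3)ⁿ` is `1 / β` for `β = (3/11)ⁿ`. -/
theorem exists_lintegral_potential_le (Y : C3 →L[ℂ] ℂ)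
    (hY : ∫⁻ X in shell, recipSec Y X ∂Measure.addHaar ≠ ∞) :
    ∃ A B : ℝ≥0∞, A ≠ ∞ ∧ B ≠ ∞ ∧ ∀ n : ℕ, ∫⁻ x, ‖potential Y n x‖ₑ ∂fubiniStudy ≤
      ENNReal.ofReal ((11 / 12) ^ n) * A + ENNReal.ofReal ((1 / 4) ^ n) * B := by
  obtain ⟨c, hc, hcmp⟩ := exists_lintegral_fubiniStudy_le
  obtain ⟨D, hD, hiter⟩ := exists_lintegral_comp_iterate_rpow_le (measurable_recipSec Y)
    (rayInvariant_recipSec Y) hY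
  set L : ℝ≥0∞ := ENNReal.ofReal (Real.log (1 + ‖Y‖)) with hL
  refine ⟨c * D, c * (L * (Measure.addHaar : Measure C3) shell), by finiteness,
    ENNReal.mul_ne_top hc (ENNReal.mul_ne_top ENNReal.ofReal_ne_top measure_shell_lt_top.ne),
    fun n => ?_⟩
  have hβ : (0 : ℝ) < (3 / 11) ^ n := by positivity
  have hm : Measurable fun X => recipSec Y (RHat^[n] X) ^ ((3 / 11 : ℝ) ^ n) :=
    ((measurable_recipSec Y).comp (continuous_RHat.iterate n).measurable).pow_const _
  have hexp : (1 / 4 : ℝ) ^ n * (1 / (3 / 11) ^ n) = (11 / 12) ^ n := by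
    rw [← one_div_pow, ← mul_pow]; norm_num
  calc ∫⁻ x, ‖potential Y n x‖ₑ ∂fubiniStudy
      ≤ c * ∫⁻ X in shell, (ENNReal.ofReal ((11 / 12) ^ n) *
          recipSec Y (RHat^[n] X) ^ ((3 / 11 : ℝ) ^ n) + ENNReal.ofReal ((1 / 4) ^ n) * L)
          ∂Measure.addHaar := by
        refine hcmp _ _ (measurable_potential Y n).enorm ((hm.const_mul _).add_const _) ?_
          fun X hX => ?_
        · intro r X hr
          simp only [((rayInvariant_recipSec Y).comp_iterate n) r X hr]
        · rw [potential_mk_eq, ← one_div_pow, enorm_mul, Real.enorm_eq_ofReal_abs,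
            Real.enorm_eq_ofReal_abs, abs_of_nonneg (by positivity : (0 : ℝ) ≤ (1 / 4) ^ n)]
          refine (mul_le_mul_right (ofReal_abs_log_le Y (RHat^[n] X) hβ) _).trans_eq ?_
          rw [mul_add, ← mul_assoc, ← ENNReal.ofReal_mul (by positivity), hexp]
    _ = c * (ENNReal.ofReal ((11 / 12) ^ n) *
          (∫⁻ X in shell, recipSec Y (RHat^[n] X) ^ ((3 / 11 : ℝ) ^ n) ∂Measure.addHaar) +
          ENNReal.ofReal ((1 / 4) ^ n) * L * (Measure.addHaar : Measure C3) shell) := by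
        rw [lintegral_add_right _ measurable_const, lintegral_const_mul _ hm, setLIntegral_const]
    _ ≤ c * (ENNReal.ofReal ((11 / 12) ^ n) * D +
          ENNReal.ofReal ((1 / 4) ^ n) * L * (Measure.addHaar : Measure C3) shell) := by
        gcongr
        exact hiter n
    _ = _ := by ring

end MigdalKadanoff

end

theorem mainTheorem4 (p q r : ℂ) (hp : p ≠ 0) (hr : r ≠ 0) :
    (∀ n : ℕ, ∀ᵐ x ∂MigdalKadanoff.fubiniStudy,
      ∃ y ∈ MigdalKadanoff.iterR n x, MigdalKadanoff.sec (MigdalKadanoff.linForm p q r) y ≠ 0) ∧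
    (∀ n : ℕ, Integrable (MigdalKadanoff.potential (MigdalKadanoff.linForm p q r) n)
      MigdalKadanoff.fubiniStudy) ∧
    Tendsto (fun n : ℕ => ∫ x, |MigdalKadanoff.potential (MigdalKadanoff.linForm p q r) n x|
      ∂MigdalKadanoff.fubiniStudy) atTop (𝓝 0) := by
  have hY := (MigdalKadanoff.lintegral_recipSec_linForm_lt_top q r hp).ne
  obtain ⟨A, B, hA, hB, hle⟩ := MigdalKadanoff.exists_lintegral_potential_le _ hY
  have hmeas := MigdalKadanoff.measurable_potential (MigdalKadanoff.linForm p q r)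
  have hlim : Tendsto (fun n : ℕ => ENNReal.ofReal ((11 / 12) ^ n) * A +
      ENNReal.ofReal ((1 / 4) ^ n) * B) atTop (𝓝 0) := by
    have hgeom : ∀ a : ℝ, 0 ≤ a → a < 1 → ∀ K : ENNReal, K ≠ ⊤ →
        Tendsto (fun n : ℕ => ENNReal.ofReal (a ^ n) * K) atTop (𝓝 0) := fun a h0 h1 K hK => by
      have h := ENNReal.tendsto_ofReal (tendsto_pow_atTop_nhds_zero_of_lt_one h0 h1)
      rw [ENNReal.ofReal_zero] at h
      simpa using ENNReal.Tendsto.mul_const h (Or.inr hK)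
    simpa using (hgeom (11 / 12) (by norm_num) (by norm_num) A hA).add
      (hgeom (1 / 4) (by norm_num) (by norm_num) B hB)
  refine ⟨MigdalKadanoff.ae_exists_mem_iterR _ hY,
    fun n => ⟨(hmeas n).aestronglyMeasurable, ?_⟩, ?_⟩
  · exact (hle n).trans_lt (by finiteness)
  · have h := tendsto_of_tendsto_of_tendsto_of_le_of_le tendsto_const_nhds hlim
      (fun _ => zero_le) hle
    have h' := (ENNReal.tendsto_toReal ENNReal.zero_ne_top).comp h
    rw [ENNReal.toReal_zero] at h'
    refine h'.congr fun n => ?_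
    exact (integral_norm_eq_lintegral_enorm (hmeas n).aestronglyMeasurable).symm
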